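/- Let $\alpha\ge 0$, $\sigma\ge 0$, let $\pi$ be a measure on $(0,\infty)$ with $\int_0^\infty (r\wedge r^2)\,\pi(dr)<\infty$, and put $$\psi(\lambda)=\alpha\lambda+\tfrac12\sigma^2\lambda^2+\int_0^\infty\left(e^{-\lambda r}-1+\lambda r\right)\pi(dr),\qquad \lambda\ge 0 .$$ Assume that $\int^{\infty}\frac{d\lambda}{\psi(\lambda)}<\infty$. Let $\phi(\lambda)=\int_\lambda^\infty \frac{du}{\psi(u)}$ for $\lambda>0$; this is a decreasing bijection of $(0,\infty)$ onto itself, and $\varphi=\phi^{-1}$ denotes its inverse. Let $(Z_t)_{t\ge 0}$, with laws $(\mathbf P_x)_{x\ge0}$, be a continuous-state branching process with branching mechanism $\psi$, i.e. a càdlàg time-homogeneous strong Markov process on $[0,\infty)$ with $Z_0=x$ $\mathbf P_x$-almost surely, with absorbing state $0$, such that $\mathbf E_x[e^{-\lambda Z_t}]=e^{-x u_t(\lambda)}$ for $\lambda>0$, where $\partial_t u_t(\lambda)=-\psi(u_t(\lambda))$ and $u_0(\lambda)=\lambda$. Let $\zeta=\inf\{t>0: Z_t=0\}$, and let $P_t(x,dy)$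 be the restriction to $(0,\infty)$ of the law of $Z_t$ under $\mathbf P_x$. For a measure $\nu$ on $(0,\infty)$ put $\mathbf P_\nu=\int\mathbf P_x\,\nu(dx)$. (i) Subcritical case. If $\alpha>0$, there is a probability measure $\nu_\alpha$ on $(0,\infty)$, the Yaglom distribution, with $$\int_{(0,\infty)} e^{-\lambda y}\,\nu_\alpha(dy)=1-e^{-\alpha\phi(\lambda)}\qquad(\lambda>0),$$ which is quasi-stationary, i.e. $\mathbf P_{\nu_\alpha}(Z_t\in A\mid \zeta>t)=\nu_\alpha(A)$ for all $t>0$ and Borel $A\subset(0,\infty)$, and which is the weak limit as $t\to\infty$ of $\mathbf P_x(Z_t\in\cdot\mid\zeta>t)$ for every $x>0$. For every $x>0$, $$\frac{1}{x\,\psi(\varphi(t))}P_t(x,dy)\ \longrightarrow\ \frac1\alpha\,\nu_\alpha(dy)\quad\text{weakly on }(0,\infty)\text{ as }t\to\infty .$$ (ii) Critical case. If $\alpha=0$, there is a scale function $W$ of $\psi$, i.e. a function that vanishes on $(-\infty,0)$, is continuous, nonnegative and strictly increasing on $[0,\infty)$, and satisfies $\int_0^\infty e^{-\lambda x}W(x)\,dx=1/\psi(\lambda)$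 for $\lambda>0$. The measure $\mu(dx)=\frac{W(x)}{x}dx$ on $(0,\infty)$ is a stationary measure of $Z$, i.e. it is locally finite and $\mathbf P_\mu(Z_t\in A)=\mu(A)$ for all $t>0$ and Borel $A\subset(0,\infty)$. For every $x>0$, $$\frac{1}{x\,\psi(\varphi(t))}P_t(x,dy)\ \longrightarrow\ \mu(dy)\quad\text{vaguely on }(0,\infty)\text{ as }t\to\infty .$$ Here weak (vague) convergence on $(0,\infty)$ means convergence of the integrals of all bounded continuous (all compactly supported continuous) functions $(0,\infty)\to[0,\infty)$. -/

import Mathlib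

open MeasureTheory ProbabilityTheory Filter Topology Set
open scoped NNReal ENNReal BoundedContinuousFunction CompactlySupported

noncomputable section

namespace CBP

/-- The open half-line `(0, ∞)`. -/
abbrev PosHalfLine : Type := Set.Ioi (0 : ℝ)

/-! ### Branching mechanisms -/

/-- The parameters `(α, σ, π)` of a branching mechanism: `σ ≥ 0` and `π` is a measure on `(0, ∞)`
with `∫ (r ∧ r²) π(dr) < ∞` (so that `π` is finite on compact subsets of `(0, ∞)`). -/
structure BranchingMechanism where
  α : ℝ
  σ : ℝ
  π : Measure PosHalfLine
  σ_nonneg : 0 ≤ σ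
  π_integrable : ∫⁻ r : PosHalfLine, ENNReal.ofReal (min (r : ℝ) ((r : ℝ) ^ 2)) ∂π < ∞

/-- `ψ(lam) = α lam + σ² lam² / 2 + ∫ (exp (-lam r) - 1 + lam r) π(dr)`, used for `lam ≥ 0`. -/
def BranchingMechanism.psi (b : BranchingMechanism) (lam : ℝ) : ℝ :=
  b.α * lam + b.σ ^ 2 * lam ^ 2 / 2
    + ∫ r : PosHalfLine, (Real.exp (-(lam * (r : ℝ))) - 1 + lam * (r : ℝ)) ∂b.π

/-- The condition `∫^∞ dlam / ψ(lam) < ∞`, the integral being taken over some neighbourhood of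
`+∞`. It is an integral in `[0, ∞]` with `1 / ψ = ∞` wherever `ψ ≤ 0`. -/
def BranchingMechanism.GreyCondition (b : BranchingMechanism) : Prop :=
  ∃ θ : ℝ, 0 < θ ∧ ∫⁻ lam in Set.Ioi θ, (ENNReal.ofReal (b.psi lam))⁻¹ < ∞

/-- `φ(lam) = ∫_lam^∞ du / ψ(u)` for `lam > 0`. -/
def BranchingMechanism.phi (b : BranchingMechanism) (lam : ℝ) : ℝ :=
  ∫ u in Set.Ioi lam, 1 / b.psi u

/-- The inverse function `φ⁻¹` of `φ : (0, ∞) → (0, ∞)`, in the (sub)critical case. -/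
def BranchingMechanism.phiInv (b : BranchingMechanism) (t : ℝ) : ℝ :=
  Function.invFunOn b.phi (Set.Ioi 0) t

/-- `v` is the solution `t ↦ u_t(lam) ≥ 0`, on `[0, ∞)`, of `∂u/∂t = -ψ(u)`, `u_0 = lam`. -/
def BranchingMechanism.IsCumulant (b : BranchingMechanism) (lam : ℝ) (v : ℝ → ℝ) : Prop :=
  v 0 = lam ∧
    ∀ t : ℝ, 0 ≤ t → 0 ≤ v t ∧ HasDerivWithinAt v (-b.psi (v t)) (Set.Ici 0) t

/-- `W` is the scale function of `ψ`: it vanishes on `(-∞, 0)`, it is continuous, nonnegative and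
strictly increasing on `[0, ∞)`, and `∫_0^∞ exp (-lam x) W(x) dx = 1 / ψ(lam)` for `lam > 0`. -/
structure IsScaleFunction (b : BranchingMechanism) (W : ℝ → ℝ) : Prop where
  zero_of_neg : ∀ x : ℝ, x < 0 → W x = 0
  continuousOn : ContinuousOn W (Set.Ici 0)
  strictMonoOn : StrictMonoOn W (Set.Ici 0)
  nonneg : ∀ x : ℝ, 0 ≤ x → 0 ≤ W x
  laplace : ∀ lam : ℝ, 0 < lam →
    ∫ x in Set.Ioi (0 : ℝ), Real.exp (-(lam * x)) * W x = 1 / b.psi lam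

/-- The measure `W(x) / x dx` on `(0, ∞)`. -/
def scaleMeasure (W : ℝ → ℝ) : Measure PosHalfLine :=
  (Measure.comap Subtype.val (volume : Measure ℝ)).withDensity
    fun x : PosHalfLine => ENNReal.ofReal (W (x : ℝ) / (x : ℝ))

/-! ### Continuous-state branching processes -/

section CBProcess

variable {Ω : Type*} [MeasurableSpace Ω]

/-- `Z` is, under the laws `Pr x` (`x ≥ 0` the initial value), a continuous-state branching process
with branching mechanism `ψ`: a càdlàg, time-homogeneous strong Markov process on `[0, ∞)`, absorbed
at `0`, such that `E_x[exp (-lam Z_t)] = exp (-x u_t(lam))`, with `∂u_t/∂t = -ψ(u_t)`,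
`u_0(lam) = lam`. -/
structure IsCBProcess (b : BranchingMechanism) (Pr : Kernel ℝ≥0 Ω) (Z : ℝ≥0 → Ω → ℝ≥0) :
    Prop where
  isMarkovKernel : IsMarkovKernel Pr
  measurable : ∀ t, StronglyMeasurable (Z t)
  rightContinuous : ∀ ω t, ContinuousWithinAt (fun s => Z s ω) (Set.Ici t) t
  leftLimits : ∀ ω t, ∃ l : ℝ≥0, Tendsto (fun s => Z s ω) (𝓝[<] t) (𝓝 l)
  start : ∀ x, ∀ᵐ ω ∂Pr x, Z 0 ω = x
  absorbed : ∀ ω s t, s ≤ t → Z s ω = 0 → Z t ω = 0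
  /-- The strong Markov property at the stopping time `τ`, on the event `A ∩ {τ < ∞}`. -/
  strongMarkov : ∀ (x : ℝ≥0) (τ : Ω → WithTop ℝ≥0)
    (hτ : IsStoppingTime (Filtration.natural Z measurable) τ)
    (A : Set Ω), MeasurableSet[hτ.measurableSpace] A →
    ∀ (t : ℝ≥0) (B : Set ℝ≥0), MeasurableSet B →
      Pr x {ω | ω ∈ A ∧ ∃ s : ℝ≥0, τ ω = s ∧ Z (s + t) ω ∈ B}
        = ∫⁻ ω in A ∩ {ω | τ ω ≠ ⊤}, Pr (Z (τ ω).untopA ω) {ω' | Z t ω' ∈ B} ∂Pr x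
  logLaplace : ∀ lam : ℝ, 0 < lam → ∃ u : ℝ → ℝ, b.IsCumulant lam u ∧
    ∀ x t : ℝ≥0, ∫ ω, Real.exp (-(lam * (Z t ω : ℝ))) ∂Pr x = Real.exp (-((x : ℝ) * u (t : ℝ)))

/-- The extinction time `ζ = inf {t > 0 : Z_t = 0}`, with `inf ∅ = ∞`. -/
def extinctionTime (Z : ℝ≥0 → Ω → ℝ≥0) (ω : Ω) : ℝ≥0∞ :=
  ⨅ (s : ℝ≥0) (_ : 0 < s ∧ Z s ω = 0), (s : ℝ≥0∞)

/-- The event `{ζ > t}`. -/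
def survival (Z : ℝ≥0 → Ω → ℝ≥0) (t : ℝ≥0) : Set Ω := {ω | (t : ℝ≥0∞) < extinctionTime Z ω}

/-- The restriction to `(0, ∞)` of the distribution of `Z_t` under the measure `m`. -/
def lawOnPos (m : Measure Ω) (Z : ℝ≥0 → Ω → ℝ≥0) (t : ℝ≥0) : Measure PosHalfLine :=
  (m.map fun ω => (Z t ω : ℝ)).comap Subtype.val

/-- `P_ν = ∫ P_x ν(dx)`, for a measure `ν` on `(0, ∞)`. -/
def initialLaw (Pr : Kernel ℝ≥0 Ω) (ν : Measure PosHalfLine) : Measure Ω :=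
  (ν.map fun x : PosHalfLine => (x : ℝ).toNNReal).bind Pr

/-- `ν` is a stationary measure on `(0, ∞)`: it is locally finite and `P_ν(Z_t ∈ A) = ν(A)`. -/
def IsStationary (Pr : Kernel ℝ≥0 Ω) (Z : ℝ≥0 → Ω → ℝ≥0) (ν : Measure PosHalfLine) : Prop :=
  IsLocallyFiniteMeasure ν ∧ ∀ t : ℝ≥0, 0 < t → ∀ A : Set PosHalfLine, MeasurableSet A →
    lawOnPos (initialLaw Pr ν) Z t A = ν A

/-- `ν_t → ν` weakly on `(0, ∞)`: convergence of the integrals of all bounded continuous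
functions `(0, ∞) → [0, ∞)`. -/
def TendstoWeakly (νs : ℝ≥0 → Measure PosHalfLine) (ν : Measure PosHalfLine) : Prop :=
  ∀ f : PosHalfLine →ᵇ ℝ≥0,
    Tendsto (fun t => ∫⁻ y, (f y : ℝ≥0∞) ∂νs t) atTop (𝓝 (∫⁻ y, (f y : ℝ≥0∞) ∂ν))

/-- `ν_t → ν` vaguely on `(0, ∞)`: convergence of the integrals of all continuous functions
`(0, ∞) → [0, ∞)` with compact support in `(0, ∞)`. -/
def TendstoVaguely (νs : ℝ≥0 → Measure PosHalfLine) (ν : Measure PosHalfLine) : Prop :=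
  ∀ f : C_c(PosHalfLine, ℝ≥0),
    Tendsto (fun t => ∫⁻ y, (f y : ℝ≥0∞) ∂νs t) atTop (𝓝 (∫⁻ y, (f y : ℝ≥0∞) ∂ν))

/-- `ν` is the Yaglom distribution `ν_α`: the quasi-stationary distribution on `(0, ∞)` with
Laplace transform `1 - exp (-α φ)`, which is the limit law of `Z_t` given `ζ > t`. -/
structure IsYaglomDistribution (b : BranchingMechanism) (Pr : Kernel ℝ≥0 Ω)
    (Z : ℝ≥0 → Ω → ℝ≥0) (ν : Measure PosHalfLine) : Prop where
  isProbabilityMeasure : IsProbabilityMeasure ν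
  laplace : ∀ lam : ℝ, 0 < lam →
    ∫ y : PosHalfLine, Real.exp (-(lam * (y : ℝ))) ∂ν = 1 - Real.exp (-(b.α * b.phi lam))
  quasiStationary : ∀ t : ℝ≥0, 0 < t → ∀ A : Set PosHalfLine, MeasurableSet A →
    lawOnPos ((initialLaw Pr ν)[|survival Z t]) Z t A = ν A
  conditionalLimit : ∀ x : ℝ≥0, 0 < x →
    TendstoWeakly (fun t => lawOnPos ((Pr x)[|survival Z t]) Z t) ν

/-- The measure `P_t(x, dy) / (x ψ(φ⁻¹(t)))` on `(0, ∞)`. -/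
def normalizedTransition (b : BranchingMechanism) (Pr : Kernel ℝ≥0 Ω) (Z : ℝ≥0 → Ω → ℝ≥0)
    (x t : ℝ≥0) : Measure PosHalfLine :=
  ENNReal.ofReal (1 / ((x : ℝ) * b.psi (b.phiInv (t : ℝ)))) • lawOnPos (Pr x) Z t

end CBProcess

end CBP

end

noncomputable section

namespace CBP

/-! ### Measures on the unit interval and their moments -/

/-! Everything is read off Laplace transforms. Since `φ' = -1/ψ`, the quantity `φ(u_t(λ)) - t` is
constant, so `u_t(λ) = φ⁻¹(t + φ(λ))` (`IsCumulant.eq_phiInv`). Letting `λ → ∞` gives `P_x(Z_t = 0)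
= exp(-x φ⁻¹(t))`. With `s = φ(λ)`, the transform of `P_t(x, ·)` on `(0, ∞)` is therefore `exp(-x
φ⁻¹(t + s)) - exp(-x φ⁻¹(t))`. After division by `x ψ(φ⁻¹(t))` it has the same limit as `(φ⁻¹(t) -
φ⁻¹(t + s)) / ψ(φ⁻¹(t))`. Convexity of `ψ` and `ψ'(0+) = α` show that this limit is `(1 - exp(-α s))
/ α` if `α > 0` and `s` if `α = 0` (`tendsto_phiInv_sub_div_subcritical`,
`tendsto_phiInv_sub_div_critical`). So the limit measures must have transforms `(1 - exp(-α φ)) / α`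
and `φ`.

If `ν` has transform `L`, then the law of `Z_t` on `(0, ∞)` under `P_ν` has transform `L(φ⁻¹(t + s))
- L(φ⁻¹(t))` at `λ` (`laplacePos_lawOnPos_initialLaw`). Written as a function of `φ`, `L` is merely
shifted by `t`. Hence `1 - exp(-α φ)` is multiplied by `exp(-α t)`, which is quasi-stationarity, and
`φ` is preserved, which is stationarity.

The Yaglom measure exists because limits of Laplace transforms are Laplace transforms. In the
critical case `ψ(λ)/λ` is the Laplace exponent of a subordinator with drift `σ²/2` and Lévy density
`π(r, ∞)`. Its potential measure `U` has transform `λ/ψ(λ)`, and `W(x) = U[0, x]`. Integrating `1/ψ`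
over `(λ, ∞)` shows that `W(x)/x dx` has transform `φ`. Continuity and strict monotonicity of `W`
say that `U` has no atoms and charges every interval; both come from the renewal identity that `U`
convolved with `renewalKernel` is Lebesgue measure.

Passing between transforms and measures uses `y ↦ exp(-y)`: values of the transform along an
arithmetic progression become moments on the compact interval `[0, 1]`. -/

lemma integrable_of_continuous_unitInterval (P : Measure unitInterval) [IsFiniteMeasure P]
    {f : unitInterval → ℝ} (hf : Continuous f) : Integrable f P :=
  hf.integrable_of_hasCompactSupport (HasCompactSupport.of_compactSpace f)

/-- Weierstrass: polynomials are uniformly dense in the continuous functions on `[0, 1]`. -/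
theorem ext_of_moments {P P' : Measure unitInterval} [IsFiniteMeasure P] [IsFiniteMeasure P']
    (h : ∀ n : ℕ, ∫ x, (x : ℝ) ^ n ∂P = ∫ x, (x : ℝ) ^ n ∂P') : P = P' := by
  have hpoly (p : Polynomial ℝ) : ∫ x : unitInterval, p.eval (x : ℝ) ∂P
      = ∫ x : unitInterval, p.eval (x : ℝ) ∂P' := by
    simp only [Polynomial.eval_eq_sum_range]
    rw [integral_finsetSum _ fun i _ => integrable_of_continuous_unitInterval _ (by fun_prop),
      integral_finsetSum _ fun i _ => integrable_of_continuous_unitInterval _ (by fun_prop)]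
    simp only [integral_const_mul, h]
  refine ext_of_forall_integral_eq_of_IsFiniteMeasure fun f => ?_
  have key : ∀ ε : ℝ, 0 < ε →
      |∫ x, f x ∂P - ∫ x, f x ∂P'| ≤ ε * (P.real univ + P'.real univ) := by
    intro ε hε
    obtain ⟨p, hp⟩ := exists_polynomial_near_continuousMap 0 1 f.toContinuousMap ε hε
    have hb (x : unitInterval) : ‖f x - p.eval (x : ℝ)‖ ≤ ε := by
      have := ContinuousMap.norm_coe_le_norm (p.toContinuousMapOn (Icc 0 1) - f.toContinuousMap) x
      rw [norm_sub_rev]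
      exact this.trans hp.le
    have hc : Continuous fun x : unitInterval => p.eval (x : ℝ) := by fun_prop
    have h1 : ‖∫ x, (f x - p.eval (x : ℝ)) ∂P‖ ≤ ε * P.real univ :=
      norm_integral_le_of_norm_le_const (.of_forall hb)
    have h2 : ‖∫ x, (f x - p.eval (x : ℝ)) ∂P'‖ ≤ ε * P'.real univ :=
      norm_integral_le_of_norm_le_const (.of_forall hb)
    rw [integral_sub (f.integrable _) (integrable_of_continuous_unitInterval _ hc),
      Real.norm_eq_abs, abs_le] at h1 h2
    rw [hpoly p] at h1
    rw [abs_le]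
    constructor <;> linarith [h1.1, h1.2, h2.1, h2.2]
  have hz : |∫ x, f x ∂P - ∫ x, f x ∂P'| ≤ 0 := by
    refine le_of_forall_pos_le_add fun δ hδ => ?_
    have hM : 0 ≤ P.real univ + P'.real univ := by positivity
    -- The `+ 1` keeps the denominator positive when both measures vanish.
    refine (key (δ / (P.real univ + P'.real univ + 1)) (by positivity)).trans ?_
    rw [zero_add, div_mul_eq_mul_div, div_le_iff₀ (by positivity)]
    nlinarith
  linarith [abs_nonpos_iff.mp hz]

/-- The zeroth moment bounds the masses eventually, and measures of bounded mass on a compact space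
form a compact set. All cluster points have moments `a`, so there is only one. -/
theorem exists_tendsto_of_moments {ι : Type*} {l : Filter ι} [l.NeBot]
    {μs : ι → FiniteMeasure unitInterval} {a : ℕ → ℝ}
    (h : ∀ n : ℕ, Tendsto (fun i => ∫ x, (x : ℝ) ^ n ∂(μs i : Measure unitInterval)) l (𝓝 (a n))) :
    ∃ μ : FiniteMeasure unitInterval, Tendsto μs l (𝓝 μ) := by
  obtain ⟨C, hC⟩ : ∃ C : ℝ≥0, ∀ᶠ i in l, μs i ∈ {μ : FiniteMeasure unitInterval | μ.mass ≤ C} := by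
    refine ⟨(a 0 + 1).toNNReal, ?_⟩
    filter_upwards [(h 0).eventually_le_const (lt_add_one _)] with i hi
    refine NNReal.coe_le_coe.mp (le_trans ?_ (Real.le_coe_toNNReal _))
    simpa using hi
  have hK := isCompact_setOfPred_finiteMeasure_le_of_compactSpace unitInterval C
  have hmom (μ : FiniteMeasure unitInterval) (hμ : MapClusterPt μ l μs) (n : ℕ) :
      ∫ x, (x : ℝ) ^ n ∂(μ : Measure unitInterval) = a n := by
    obtain ⟨U, hU, hUμ⟩ := mapClusterPt_iff_ultrafilter.mp hμ
    have h1 := FiniteMeasure.tendsto_iff_forall_integral_tendsto.mp hUμ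
      (BoundedContinuousFunction.mkOfCompact ⟨fun x : unitInterval => (x : ℝ) ^ n, by fun_prop⟩)
    exact tendsto_nhds_unique h1 ((h n).mono_left hU)
  obtain ⟨μ, -, hμ⟩ := hK.exists_mapClusterPt_of_frequently hC.frequently
  refine ⟨μ, hK.tendsto_nhds_of_unique_mapClusterPt hC fun μ' _ hμ' => ?_⟩
  exact FiniteMeasure.toMeasure_injective (ext_of_moments fun n => by
    simpa using (hmom μ' hμ' n).trans (hmom μ hμ n).symm)

theorem tendsto_of_moments {ι : Type*} {l : Filter ι} {μs : ι → FiniteMeasure unitInterval}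
    {μ : FiniteMeasure unitInterval}
    (h : ∀ n : ℕ, Tendsto (fun i => ∫ x, (x : ℝ) ^ n ∂(μs i : Measure unitInterval)) l
      (𝓝 (∫ x, (x : ℝ) ^ n ∂(μ : Measure unitInterval)))) : Tendsto μs l (𝓝 μ) := by
  rcases l.eq_or_neBot with rfl | hl
  · exact tendsto_bot
  obtain ⟨μ', hμ'⟩ := exists_tendsto_of_moments h
  have : μ' = μ := FiniteMeasure.toMeasure_injective (ext_of_moments fun n => tendsto_nhds_unique
    (FiniteMeasure.tendsto_iff_forall_integral_tendsto.mp hμ'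
      (BoundedContinuousFunction.mkOfCompact ⟨fun x : unitInterval => (x : ℝ) ^ n, by fun_prop⟩))
    (h n))
  exact this ▸ hμ'

/-! ### Laplace transforms of measures on the half-line -/

/-- The Laplace transform of a measure on the line, with values in `[0, ∞]`. -/
def laplace (m : Measure ℝ) (lam : ℝ) : ℝ≥0∞ := ∫⁻ y, ENNReal.ofReal (Real.exp (-(lam * y))) ∂m

/-- The map `y ↦ exp (-y)` from the half-line to the unit interval. -/
def expI (y : ℝ) : unitInterval :=
  ⟨Real.exp (-max y 0), (Real.exp_pos _).le, Real.exp_le_one_iff.mpr (by simp)⟩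

lemma continuous_expI : Continuous expI := by
  unfold expI; fun_prop

lemma coe_expI {y : ℝ} (hy : 0 ≤ y) : (expI y : ℝ) = Real.exp (-y) := by
  simp [expI, max_eq_left hy]

/-- The image under `y ↦ exp (-y)` of the measure `exp (-c y) m(dy)`. -/
def tilt (c : ℝ) (m : Measure ℝ) : Measure unitInterval :=
  (m.withDensity fun y => ENNReal.ofReal (Real.exp (-(c * y)))).map expI

lemma lintegral_tilt (c : ℝ) (m : Measure ℝ) {g : unitInterval → ℝ≥0∞} (hg : Measurable g) :
    ∫⁻ x, g x ∂(tilt c m) = ∫⁻ y, ENNReal.ofReal (Real.exp (-(c * y))) * g (expI y) ∂m := by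
  rw [tilt, lintegral_map hg continuous_expI.measurable,
    lintegral_withDensity_eq_lintegral_mul _ (by fun_prop)
      (g := fun y => g (expI y)) (hg.comp continuous_expI.measurable)]
  rfl

lemma ae_nonneg_of_Iio {m : Measure ℝ} (hm : m (Iio 0) = 0) : ∀ᵐ y ∂m, 0 ≤ y := by
  rw [ae_iff]; simpa [Iio] using hm

lemma lintegral_tilt_rpow (c : ℝ) {m : Measure ℝ} (hm : m (Iio 0) = 0) (s : ℝ) :
    ∫⁻ x : unitInterval, ENNReal.ofReal ((x : ℝ) ^ s) ∂(tilt c m) = laplace m (c + s) := by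
  rw [lintegral_tilt c m (by fun_prop), laplace]
  refine lintegral_congr_ae ?_
  filter_upwards [ae_nonneg_of_Iio hm] with y hy
  rw [coe_expI hy, ← ENNReal.ofReal_mul (Real.exp_pos _).le, ← Real.exp_mul, ← Real.exp_add]
  congr 2; ring

lemma tilt_univ (c : ℝ) {m : Measure ℝ} (hm : m (Iio 0) = 0) :
    tilt c m univ = laplace m c := by
  have := lintegral_tilt_rpow c hm 0
  simpa using this

lemma integral_tilt_pow (c : ℝ) {m : Measure ℝ} (hm : m (Iio 0) = 0) (n : ℕ) :
    ∫ x : unitInterval, (x : ℝ) ^ n ∂(tilt c m) = (laplace m (c + n)).toReal := by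
  rw [integral_eq_lintegral_of_nonneg_ae (.of_forall fun x => pow_nonneg x.2.1 n)
    (by fun_prop), ← lintegral_tilt_rpow c hm n]
  simp

lemma untilt_tilt (c : ℝ) {m : Measure ℝ} (hm : m (Iio 0) = 0) :
    ((tilt c m).map fun x : unitInterval => -Real.log x).withDensity
      (fun y => ENNReal.ofReal (Real.exp (c * y))) = m := by
  have hlog : Measurable fun x : unitInterval => -Real.log x := by fun_prop
  have h1 : ((fun x : unitInterval => -Real.log x) ∘ expI)
      =ᵐ[m.withDensity fun y => ENNReal.ofReal (Real.exp (-(c * y)))] id := by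
    refine (withDensity_absolutelyContinuous m _).ae_le ?_
    filter_upwards [ae_nonneg_of_Iio hm] with y hy
    simp [coe_expI hy]
  rw [tilt, Measure.map_map hlog continuous_expI.measurable, Measure.map_congr h1, Measure.map_id,
    ← withDensity_mul _ (by fun_prop) (by fun_prop)]
  convert withDensity_one using 2
  ext y
  simp [← ENNReal.ofReal_mul (Real.exp_pos _).le, ← Real.exp_add]

/-- A measure on the half-line is determined by its Laplace transform. -/
theorem ext_of_laplace {m m' : Measure ℝ} (hm : m (Iio 0) = 0) (hm' : m' (Iio 0) = 0) (a : ℝ)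
    (hfin : ∀ lam, a < lam → laplace m lam ≠ ∞)
    (h : ∀ lam, a < lam → laplace m lam = laplace m' lam) : m = m' := by
  have ha : a < a + 1 := lt_add_one a
  have : IsFiniteMeasure (tilt (a + 1) m) := ⟨by
    rw [tilt_univ _ hm]; exact (hfin _ ha).lt_top⟩
  have : IsFiniteMeasure (tilt (a + 1) m') := ⟨by
    rw [tilt_univ _ hm', ← h _ ha]; exact (hfin _ ha).lt_top⟩
  -- The `n`-th moment of the tilted measure is the transform at `a + 1 + n`, so this sequence of
  -- values already determines the measure.
  have key : tilt (a + 1) m = tilt (a + 1) m' := ext_of_moments fun n => by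
    rw [integral_tilt_pow _ hm, integral_tilt_pow _ hm', h]
    have : (0 : ℝ) ≤ n := Nat.cast_nonneg n
    linarith
  rw [← untilt_tilt (a + 1) hm, key, untilt_tilt (a + 1) hm']

/-- The measure with value `m` where `m` is finite, and `0` otherwise. -/
def toFinite {X : Type*} [MeasurableSpace X] (m : Measure X) : FiniteMeasure X :=
  open Classical in ⟨if IsFiniteMeasure m then m else 0, by split_ifs <;> infer_instance⟩

lemma toFinite_of_finite {X : Type*} [MeasurableSpace X] {m : Measure X}
    (h : m univ < ∞) : (toFinite m : Measure X) = m := by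
  exact if_pos ⟨h⟩

/-- The tilted images on `[0, 1]` have convergent moments, hence a weak limit. Its mass at the point
`0` is mass that escaped to `y = ∞`. Discarding it changes nothing for `lam > c`, where `x ^ (lam -
c)` vanishes at `0`; this is why the conclusion needs the strict inequality. -/
lemma exists_measure_of_tendsto_laplace_aux {ι : Type*} {l : Filter ι} [l.NeBot]
    {ms : ι → Measure ℝ} (hms : ∀ i, ms i (Iio 0) = 0) {L : ℝ → ℝ≥0∞} {c : ℝ}
    (hL : ∀ lam, c ≤ lam → L lam ≠ ∞)
    (h : ∀ lam, c ≤ lam → Tendsto (fun i => laplace (ms i) lam) l (𝓝 (L lam))) :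
    ∃ m : Measure ℝ, m (Iio 0) = 0 ∧ ∀ lam, c < lam → laplace m lam = L lam := by
  have hev : ∀ᶠ i in l, (toFinite (tilt c (ms i)) : Measure unitInterval) = tilt c (ms i) := by
    filter_upwards [(h c le_rfl).eventually_lt_const (hL c le_rfl).lt_top] with i hi
    exact toFinite_of_finite (by rwa [tilt_univ _ (hms i)])
  obtain ⟨μ, hμ⟩ := exists_tendsto_of_moments (l := l) (μs := fun i => toFinite (tilt c (ms i)))
    (a := fun n => (L (c + n)).toReal) fun n => by
      have hn : c ≤ c + n := le_add_of_nonneg_right (Nat.cast_nonneg n)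
      refine ((ENNReal.tendsto_toReal (hL _ hn)).comp (h _ hn)).congr' ?_
      filter_upwards [hev] with i hi
      rw [hi, integral_tilt_pow _ (hms i)]; rfl
  have hlog : Measurable fun x : unitInterval => -Real.log x := by fun_prop
  refine ⟨(((μ : Measure unitInterval).restrict {0}ᶜ).map fun x : unitInterval => -Real.log x).withDensity
      (fun y => ENNReal.ofReal (Real.exp (c * y))), ?_, fun lam hlam => ?_⟩
  · refine withDensity_absolutelyContinuous _ _ ?_
    rw [Measure.map_apply hlog measurableSet_Iio]
    convert measure_empty (μ := (μ : Measure unitInterval).restrict {0}ᶜ)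
    ext x
    simpa using Real.log_nonpos x.2.1 x.2.2
  · have hs : 0 < lam - c := sub_pos.mpr hlam
    have h1 := FiniteMeasure.tendsto_iff_forall_lintegral_tendsto.mp hμ
      (BoundedContinuousFunction.mkOfCompact
        ⟨fun x : unitInterval => ((x : ℝ) ^ (lam - c)).toNNReal, by
          have : Continuous fun x : unitInterval => (x : ℝ) ^ (lam - c) :=
            continuous_subtype_val.rpow_const fun _ => Or.inr hs.le
          exact continuous_real_toNNReal.comp this⟩)
    have h2 : ∫⁻ x : unitInterval, ENNReal.ofReal ((x : ℝ) ^ (lam - c)) ∂(μ : Measure unitInterval)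
        = L lam := by
      refine tendsto_nhds_unique h1 ((h lam hlam.le).congr' ?_)
      filter_upwards [hev] with i hi
      rw [hi]
      refine Eq.trans ?_ (lintegral_tilt_rpow c (hms i) _).symm
      rw [add_sub_cancel]
    rw [← h2, laplace, lintegral_withDensity_eq_lintegral_mul _ (by fun_prop) (by fun_prop),
      lintegral_map (by fun_prop) hlog, ← lintegral_add_compl
        (fun x : unitInterval => ENNReal.ofReal ((x : ℝ) ^ (lam - c))) (measurableSet_singleton 0)]
    have h0 : ∫⁻ x : unitInterval in {0}, ENNReal.ofReal ((x : ℝ) ^ (lam - c))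
        ∂(μ : Measure unitInterval) = 0 := by
      simp [Real.zero_rpow hs.ne']
    rw [h0, zero_add]
    refine setLIntegral_congr_fun (measurableSet_singleton 0).compl fun x hx => ?_
    have hx0 : 0 < (x : ℝ) := lt_of_le_of_ne x.2.1 fun h => hx (Subtype.ext h.symm)
    simp only [Pi.mul_apply]
    rw [← ENNReal.ofReal_mul (Real.exp_pos _).le, ← Real.exp_add, Real.rpow_def_of_pos hx0]
    congr 2; ring

/-- A pointwise limit of Laplace transforms of measures on the half-line is again the Laplace
transform of a measure. -/
theorem exists_measure_of_tendsto_laplace {ι : Type*} {l : Filter ι} [l.NeBot]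
    {ms : ι → Measure ℝ} (hms : ∀ i, ms i (Iio 0) = 0) {L : ℝ → ℝ≥0∞}
    (hL : ∀ lam, 0 < lam → L lam ≠ ∞)
    (h : ∀ lam, 0 < lam → Tendsto (fun i => laplace (ms i) lam) l (𝓝 (L lam))) :
    ∃ m : Measure ℝ, m (Iio 0) = 0 ∧ ∀ lam, 0 < lam → laplace m lam = L lam := by
  obtain ⟨m, hm, hmL⟩ := exists_measure_of_tendsto_laplace_aux (c := 1) hms
    (fun lam h1 => hL lam (by linarith)) fun lam h1 => h lam (by linarith)
  refine ⟨m, hm, fun lam hlam => ?_⟩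
  -- Each tilt controls the transform only beyond its own parameter. The measures obtained from `1`
  -- and `lam / 2` agree because their transforms agree beyond the maximum of the two.
  obtain ⟨m', hm', hmL'⟩ := exists_measure_of_tendsto_laplace_aux (c := lam / 2) hms
    (fun x h1 => hL x (by linarith)) fun x h1 => h x (by linarith)
  have : m = m' := by
    refine ext_of_laplace hm hm' (max 1 (lam / 2)) (fun x hx => ?_) fun x hx => ?_
    · have := max_lt_iff.mp hx
      rw [hmL x this.1]; exact hL x (by linarith)
    · have := max_lt_iff.mp hx
      rw [hmL x this.1, hmL' x this.2]
  rw [this, hmL' lam (by linarith)]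

/-! ### Weak and vague convergence on `(0, ∞)` by means of Laplace transforms -/

/-- The Laplace transform of a measure on `(0, ∞)`. -/
def laplacePos (ν : Measure PosHalfLine) (lam : ℝ) : ℝ≥0∞ :=
  ∫⁻ y : PosHalfLine, ENNReal.ofReal (Real.exp (-(lam * (y : ℝ)))) ∂ν

lemma laplace_map_val (ν : Measure PosHalfLine) (lam : ℝ) :
    laplace (ν.map Subtype.val) lam = laplacePos ν lam := by
  rw [laplace, lintegral_map (by fun_prop) measurable_subtype_coe, laplacePos]

lemma laplacePos_zero (ν : Measure PosHalfLine) : laplacePos ν 0 = ν univ := by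
  simp [laplacePos]

lemma map_val_Iio (ν : Measure PosHalfLine) : ν.map Subtype.val (Iio (0 : ℝ)) = 0 := by
  rw [Measure.map_apply measurable_subtype_coe measurableSet_Iio]
  convert measure_empty (μ := ν)
  ext y
  simpa using (mem_Ioi.mp y.2).le

lemma map_val_injective : Function.Injective
    fun ν : Measure PosHalfLine => ν.map (Subtype.val : PosHalfLine → ℝ) :=
  (MeasurableEmbedding.subtype_coe measurableSet_Ioi).map_injective

theorem ext_of_laplacePos {ν ν' : Measure PosHalfLine}
    (hfin : ∀ lam, 0 < lam → laplacePos ν lam ≠ ∞)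
    (h : ∀ lam, 0 < lam → laplacePos ν lam = laplacePos ν' lam) : ν = ν' :=
  map_val_injective <| ext_of_laplace (map_val_Iio ν) (map_val_Iio ν') 0
    (fun lam hlam => by rw [laplace_map_val]; exact hfin lam hlam)
    fun lam hlam => by rw [laplace_map_val, laplace_map_val]; exact h lam hlam

lemma laplacePos_smul (c : ℝ≥0∞) (ν : Measure PosHalfLine) (lam : ℝ) :
    laplacePos (c • ν) lam = c * laplacePos ν lam := by
  simp [laplacePos, lintegral_smul_measure]

/-- A bounded function with values in `ℝ≥0`. -/
def bcfOfLe (f : PosHalfLine → ℝ≥0) (hf : Continuous f) (C : ℝ≥0) (hC : ∀ y, f y ≤ C) :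
    PosHalfLine →ᵇ ℝ≥0 :=
  BoundedContinuousFunction.mkOfBound ⟨f, hf⟩ C fun x y => by
    have h1 := NNReal.coe_le_coe.mpr (hC x)
    have h2 := NNReal.coe_le_coe.mpr (hC y)
    have h3 := (f x).2
    have h4 := (f y).2
    simp only [ContinuousMap.coe_mk, NNReal.dist_eq, abs_le]
    constructor <;> linarith

lemma exists_forall_le (f : PosHalfLine →ᵇ ℝ≥0) : ∃ C : ℝ≥0, ∀ y, f y ≤ C := by
  refine ⟨nndist f 0, fun y => ?_⟩
  have := f.dist_coe_le_dist (g := 0) y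
  simpa [NNReal.dist_eq, ← NNReal.coe_le_coe] using this

/-- The continuous function `y ↦ exp (-y) (1 - exp (-y))`, which vanishes at both ends of
`(0, ∞)`. -/
def bump (y : PosHalfLine) : ℝ≥0 :=
  (Real.exp (-(y : ℝ)) * (1 - Real.exp (-(y : ℝ)))).toNNReal

lemma continuous_bump : Continuous bump := by
  unfold bump; fun_prop

lemma bump_pos (y : PosHalfLine) : 0 < bump y := by
  have : Real.exp (-(y : ℝ)) < 1 := by
    rw [← Real.exp_zero]
    exact Real.exp_lt_exp.mpr (by linarith [mem_Ioi.mp y.2])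
  exact Real.toNNReal_pos.mpr (mul_pos (Real.exp_pos _) (by linarith))

lemma lintegral_tilt_zero (ν : Measure PosHalfLine) {g : unitInterval → ℝ≥0∞} (hg : Measurable g) :
    ∫⁻ x, g x ∂(tilt 0 (ν.map Subtype.val)) = ∫⁻ y : PosHalfLine, g (expI y) ∂ν := by
  rw [lintegral_tilt _ _ hg, lintegral_map
    (f := fun y => ENNReal.ofReal (Real.exp (-(0 * y))) * g (expI y))
    (.mul (by fun_prop) (hg.comp continuous_expI.measurable)) measurable_subtype_coe]
  simp

/-- In the variable `x = exp(-y)` the bump is `x (1 - x)`. It vanishes at both ends, so its product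
with a bounded `f` extends by `0`, however `f` oscillates near `0` and `∞`. -/
lemma exists_continuous_extension_mul_bump (f : PosHalfLine →ᵇ ℝ≥0) :
    ∃ F : C(unitInterval, ℝ≥0), ∀ y : PosHalfLine, F (expI y) = f y * bump y := by
  obtain ⟨C, hC⟩ := exists_forall_le f
  let g : ℝ → ℝ := fun y => if h : 0 < y then f ⟨y, h⟩ else 0
  have hgval (y : PosHalfLine) : g y = f y := dif_pos y.2
  have hgcont : ContinuousOn g (Ioi 0) := by
    rw [continuousOn_iff_continuous_domRestrict]
    have : (Ioi (0 : ℝ)).domRestrict g = fun y : PosHalfLine => (f y : ℝ) := funext hgval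
    rw [this]
    exact NNReal.continuous_coe.comp f.continuous
  have hgbd (y : ℝ) : ‖g y‖ ≤ C := by
    by_cases h : 0 < y
    · simpa [g, h] using hC _
    · simp [g, h]
  let F : unitInterval → ℝ := fun x => (x : ℝ) * (1 - x) * g (-Real.log x)
  have hF : Continuous F := by
    rw [continuous_iff_continuousAt]
    intro x
    by_cases hx : (x : ℝ) * (1 - x) = 0
    · have h0 : F x = 0 := by simp [F, hx]
      rw [ContinuousAt, h0]
      refine squeeze_zero_norm (a := fun z : unitInterval => |(z : ℝ) * (1 - z)| * C) (fun z => ?_) ?_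
      · simp only [F, norm_mul, Real.norm_eq_abs, abs_mul]
        exact mul_le_mul_of_nonneg_left (hgbd _) (by positivity)
      · have : Continuous fun z : unitInterval => |(z : ℝ) * (1 - z)| * (C : ℝ) := by fun_prop
        simpa [hx] using this.tendsto x
    · have h1 : (x : ℝ) ≠ 0 := left_ne_zero_of_mul hx
      have h2 : (x : ℝ) < 1 := lt_of_le_of_ne x.2.2 fun h => by simp [h] at hx
      have h3 : 0 < (x : ℝ) := lt_of_le_of_ne x.2.1 (Ne.symm h1)
      have hlog : ContinuousAt (fun z : unitInterval => -Real.log z) x :=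
        (continuous_subtype_val.continuousAt.log h1).neg
      have hgx : ContinuousAt g (-Real.log x) :=
        hgcont.continuousAt (Ioi_mem_nhds (by simpa using Real.log_neg h3 h2))
      have h4 : ContinuousAt (fun z : unitInterval => g (-Real.log z)) x :=
        ContinuousAt.comp (f := fun z : unitInterval => -Real.log z) hgx hlog
      exact ContinuousAt.mul (by fun_prop) h4
  refine ⟨⟨fun x => (F x).toNNReal, by fun_prop⟩, fun y => ?_⟩
  have hy : 0 ≤ (y : ℝ) := (mem_Ioi.mp y.2).le
  simp only [ContinuousMap.coe_mk, F, coe_expI hy, Real.log_exp, neg_neg, hgval, bump]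
  rw [mul_comm, Real.toNNReal_mul (f y).coe_nonneg, Real.toNNReal_coe]

lemma monotone_min_div_bump (y : PosHalfLine) :
    Tendsto (fun n : ℕ => min (n * bump y) 1) atTop (𝓝 1) := by
  refine tendsto_const_nhds.congr' ?_
  obtain ⟨N, hN⟩ := exists_nat_ge (bump y)⁻¹
  filter_upwards [eventually_ge_atTop N] with n hn
  refine (min_eq_right ?_).symm
  have h1 : (bump y)⁻¹ ≤ n := hN.trans (by exact_mod_cast hn)
  have := mul_le_mul_left h1 (bump y)
  rwa [inv_mul_cancel₀ (bump_pos y).ne'] at this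

/-- Measures on `(0, ∞)` whose Laplace transforms and total masses converge to those of a finite
measure on `(0, ∞)` converge weakly. -/
theorem tendsto_lintegral_of_tendsto_laplacePos {ι : Type*} {l : Filter ι}
    {νs : ι → Measure PosHalfLine} {ν : Measure PosHalfLine} (hν : ν univ ≠ ∞)
    (h : ∀ n : ℕ, Tendsto (fun i => laplacePos (νs i) n) l (𝓝 (laplacePos ν n)))
    (f : PosHalfLine →ᵇ ℝ≥0) :
    Tendsto (fun i => ∫⁻ y, (f y : ℝ≥0∞) ∂νs i) l (𝓝 (∫⁻ y, (f y : ℝ≥0∞) ∂ν)) := by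
  have hmass : Tendsto (fun i => νs i univ) l (𝓝 (ν univ)) := by
    simpa [laplacePos_zero] using h 0
  have hfin (n : ℕ) : laplacePos ν n ≠ ∞ := by
    refine ne_top_of_le_ne_top hν ?_
    rw [← laplacePos_zero]
    refine lintegral_mono fun y => ENNReal.ofReal_le_ofReal (Real.exp_le_exp.mpr ?_)
    have := mul_nonneg (Nat.cast_nonneg (α := ℝ) n) (mem_Ioi.mp y.2).le
    linarith
  let T : Measure PosHalfLine → FiniteMeasure unitInterval :=
    fun m => toFinite (tilt 0 (m.map Subtype.val))
  have hT (m : Measure PosHalfLine) (hm : m univ < ∞) :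
      (T m : Measure unitInterval) = tilt 0 (m.map Subtype.val) := by
    refine toFinite_of_finite ?_
    rwa [tilt_univ _ (map_val_Iio m), laplace_map_val, laplacePos_zero]
  have hev : ∀ᶠ i in l, νs i univ < ∞ := hmass.eventually_lt_const hν.lt_top
  have hconv : Tendsto (fun i => T (νs i)) l (𝓝 (T ν)) := by
    refine tendsto_of_moments fun n => ?_
    rw [hT ν hν.lt_top, integral_tilt_pow _ (map_val_Iio ν), laplace_map_val, zero_add]
    refine ((ENNReal.tendsto_toReal (hfin n)).comp (h n)).congr' ?_
    filter_upwards [hev] with i hi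
    rw [hT _ hi, integral_tilt_pow _ (map_val_Iio _), laplace_map_val, zero_add]; rfl
  have hbump (g : PosHalfLine →ᵇ ℝ≥0) :
      Tendsto (fun i => ∫⁻ y, ((g y * bump y : ℝ≥0) : ℝ≥0∞) ∂νs i) l
        (𝓝 (∫⁻ y, ((g y * bump y : ℝ≥0) : ℝ≥0∞) ∂ν)) := by
    obtain ⟨F, hF⟩ := exists_continuous_extension_mul_bump g
    have h1 := FiniteMeasure.tendsto_iff_forall_lintegral_tendsto.mp hconv
      (BoundedContinuousFunction.mkOfCompact F)
    have h2 (m : Measure PosHalfLine) (hm : m univ < ∞) :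
        ∫⁻ x, (BoundedContinuousFunction.mkOfCompact F x : ℝ≥0∞) ∂(T m : Measure unitInterval)
          = ∫⁻ y, ((g y * bump y : ℝ≥0) : ℝ≥0∞) ∂m := by
      rw [hT m hm, lintegral_tilt_zero _ (by fun_prop)]
      simp [hF]
    rw [h2 ν hν.lt_top] at h1
    exact h1.congr' (hev.mono fun i hi => h2 _ hi)
  -- The cut-off `min (n * bump) 1` is `bump` times the bounded function `min n (1 / bump)`, so
  -- `hbump` applies. It increases to `1` with `n`.
  have hcut (g : PosHalfLine →ᵇ ℝ≥0) (n : ℕ) :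
      Tendsto (fun i => ∫⁻ y, ((g y * min (n * bump y) 1 : ℝ≥0) : ℝ≥0∞) ∂νs i) l
        (𝓝 (∫⁻ y, ((g y * min (n * bump y) 1 : ℝ≥0) : ℝ≥0∞) ∂ν)) := by
    obtain ⟨C, hC⟩ := exists_forall_le g
    have h1 := hbump (bcfOfLe (fun y => g y * min (n : ℝ≥0) (bump y)⁻¹)
      (g.continuous.mul (continuous_const.min
        (continuous_bump.inv₀ fun y => (bump_pos y).ne'))) (C * n)
      fun y => mul_le_mul' (hC y) (min_le_left _ _))
    have h2 (y : PosHalfLine) :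
        g y * min (n * bump y) 1 = g y * min (n : ℝ≥0) (bump y)⁻¹ * bump y := by
      rw [mul_assoc, min_mul_of_nonneg _ _ (bump_pos y).le, inv_mul_cancel₀ (bump_pos y).ne']
    simp_rw [h2]
    exact h1
  -- Lower semicontinuity along an ultrafilter, where limits in `[0, ∞]` always exist. Applied to
  -- `f` and to `C - f`, and combined with convergence of the masses, it yields equality.
  have hlow (g : PosHalfLine →ᵇ ℝ≥0) {U : Ultrafilter ι} (hU : ↑U ≤ l) {a : ℝ≥0∞}
      (ha : Tendsto (fun i => ∫⁻ y, (g y : ℝ≥0∞) ∂νs i) U (𝓝 a)) :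
      ∫⁻ y, (g y : ℝ≥0∞) ∂ν ≤ a := by
    have h1 : Tendsto (fun n : ℕ => ∫⁻ y, ((g y * min (n * bump y) 1 : ℝ≥0) : ℝ≥0∞) ∂ν) atTop
        (𝓝 (∫⁻ y, (g y : ℝ≥0∞) ∂ν)) := by
      refine lintegral_tendsto_of_tendsto_of_monotone (fun n => ?_) (.of_forall fun y => ?_)
        (.of_forall fun y => ?_)
      · have := continuous_bump
        exact Continuous.aemeasurable (by fun_prop)
      · intro n m hnm
        simp only
        gcongr
      · simpa using ENNReal.tendsto_coe.mpr ((monotone_min_div_bump y).const_mul (g y))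
    refine le_of_tendsto' h1 fun n => ?_
    refine le_of_tendsto_of_tendsto' ((hcut g n).mono_left hU) ha fun i => ?_
    refine lintegral_mono fun y => ENNReal.coe_le_coe.mpr ?_
    exact mul_le_of_le_one_right' (min_le_right _ _)
  obtain ⟨C, hC⟩ := exists_forall_le f
  let g : PosHalfLine →ᵇ ℝ≥0 := bcfOfLe (fun y => C - f y)
    (continuous_const.sub f.continuous) C fun y => tsub_le_self
  have hsum (m : Measure PosHalfLine) :
      ∫⁻ y, (f y : ℝ≥0∞) ∂m + ∫⁻ y, (g y : ℝ≥0∞) ∂m = C * m univ := by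
    rw [← lintegral_add_left (by fun_prop), ← lintegral_const]
    refine lintegral_congr fun y => ?_
    rw [← ENNReal.coe_add]
    exact congrArg _ (add_tsub_cancel_of_le (hC y))
  rw [tendsto_iff_ultrafilter]
  intro U hU
  have hlim (u : ι → ℝ≥0∞) : ∃ a, Tendsto u U (𝓝 a) := ⟨_, (U.map u).le_nhds_lim⟩
  obtain ⟨a, ha⟩ := hlim fun i => ∫⁻ y, (f y : ℝ≥0∞) ∂νs i
  obtain ⟨a', ha'⟩ := hlim fun i => ∫⁻ y, (g y : ℝ≥0∞) ∂νs i
  have h1 := hlow f hU ha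
  have h2 := hlow g hU ha'
  have h3 : a + a' = ∫⁻ y, (f y : ℝ≥0∞) ∂ν + ∫⁻ y, (g y : ℝ≥0∞) ∂ν := by
    rw [hsum]
    refine tendsto_nhds_unique (ha.add ha') ?_
    simp_rw [hsum]
    exact ENNReal.Tendsto.const_mul (hmass.mono_left hU) (Or.inr ENNReal.coe_ne_top)
  have hne : ∫⁻ y, (g y : ℝ≥0∞) ∂ν ≠ ∞ := by
    refine ne_top_of_le_ne_top (ENNReal.mul_ne_top (ENNReal.coe_ne_top (r := C)) hν) ?_
    rw [← hsum ν]; exact le_add_self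
  have h4 : a ≤ ∫⁻ y, (f y : ℝ≥0∞) ∂ν :=
    (ENNReal.add_le_add_iff_right hne).mp ((add_le_add_right h2 a).trans h3.le)
  rw [le_antisymm h1 h4]
  exact ha

/-- Measures on `(0, ∞)` whose Laplace transforms converge to the finite Laplace transform of a
measure on `(0, ∞)` converge vaguely. -/
theorem tendsto_lintegral_compactlySupported_of_tendsto_laplacePos {ι : Type*} {l : Filter ι}
    {νs : ι → Measure PosHalfLine} {ν : Measure PosHalfLine}
    (hν : ∀ lam, 0 < lam → laplacePos ν lam ≠ ∞)
    (h : ∀ lam, 0 < lam → Tendsto (fun i => laplacePos (νs i) lam) l (𝓝 (laplacePos ν lam)))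
    (f : C_c(PosHalfLine, ℝ≥0)) :
    Tendsto (fun i => ∫⁻ y, (f y : ℝ≥0∞) ∂νs i) l (𝓝 (∫⁻ y, (f y : ℝ≥0∞) ∂ν)) := by
  -- Weighting by `exp(-y)` makes the limit finite and shifts transforms by `1`. The test function
  -- is multiplied by `exp(y)` and stays bounded thanks to its compact support.
  let d : PosHalfLine → ℝ≥0∞ := fun y => ENNReal.ofReal (Real.exp (-(y : ℝ)))
  have hd : Measurable d := by fun_prop
  have hlap (m : Measure PosHalfLine) (n : ℕ) :
      laplacePos (m.withDensity d) n = laplacePos m (1 + n) := by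
    rw [laplacePos, lintegral_withDensity_eq_lintegral_mul _ hd (by fun_prop)]
    refine lintegral_congr fun y => ?_
    simp only [Pi.mul_apply, d]
    rw [← ENNReal.ofReal_mul (Real.exp_pos _).le, ← Real.exp_add]
    congr 2; ring
  have hcont : Continuous fun y : PosHalfLine => f y * (Real.exp y).toNNReal :=
    f.continuous.mul (by fun_prop)
  have hsupp : HasCompactSupport fun y : PosHalfLine => f y * (Real.exp y).toNNReal :=
    f.hasCompactSupport.mul_right
  obtain ⟨C, hC⟩ : ∃ C : ℝ≥0, ∀ y, f y * (Real.exp y).toNNReal ≤ C := by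
    obtain ⟨C, hC⟩ := (hsupp.isCompact_range hcont).bddAbove
    exact ⟨C, fun y => hC (mem_range_self y)⟩
  have key := tendsto_lintegral_of_tendsto_laplacePos (l := l)
    (νs := fun i => (νs i).withDensity d) (ν := ν.withDensity d)
    (by
      rw [← laplacePos_zero]
      have := hlap ν 0
      simp only [Nat.cast_zero, add_zero] at this
      rw [this]; exact hν 1 one_pos)
    (fun n => by
      simp_rw [hlap]
      exact h _ (by positivity)) (bcfOfLe _ hcont C hC)
  have hint (m : Measure PosHalfLine) :
      ∫⁻ y, (bcfOfLe _ hcont C hC y : ℝ≥0∞) ∂(m.withDensity d) = ∫⁻ y, (f y : ℝ≥0∞) ∂m := by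
    rw [lintegral_withDensity_eq_lintegral_mul _ hd (by fun_prop)]
    refine lintegral_congr fun y => ?_
    change ENNReal.ofReal (Real.exp (-(y : ℝ))) * ((f y * (Real.exp y).toNNReal : ℝ≥0) : ℝ≥0∞) = _
    rw [ENNReal.coe_mul, mul_left_comm, ← ENNReal.ofReal, ← ENNReal.ofReal_mul (Real.exp_pos _).le,
      ← Real.exp_add]
    simp
  simp_rw [hint] at key
  exact key

/-! ### Branching mechanisms -/

namespace BranchingMechanism

lemma kernel_nonneg (lam r : ℝ) : 0 ≤ Real.exp (-(lam * r)) - 1 + lam * r := by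
  linarith [Real.add_one_le_exp (-(lam * r))]

lemma kernel_le_sq {x : ℝ} (hx : 0 ≤ x) : Real.exp (-x) - 1 + x ≤ x ^ 2 := by
  have h1 : Real.exp (-x) ≤ 1 / (1 + x) := by
    rw [Real.exp_neg, ← one_div]
    exact one_div_le_one_div_of_le (by linarith) (by linarith [Real.add_one_le_exp x])
  have h2 : 1 / (1 + x) ≤ 1 - x + x ^ 2 := by
    rw [div_le_iff₀ (by linarith)]
    nlinarith [pow_nonneg hx 3]
  linarith

/-- The domination that makes the integral in `ψ` converge under the assumption on `π`. -/
lemma kernel_le {lam r : ℝ} (hlam : 0 ≤ lam) (hr : 0 ≤ r) :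
    Real.exp (-(lam * r)) - 1 + lam * r ≤ (lam + lam ^ 2) * min r (r ^ 2) := by
  have hx : 0 ≤ lam * r := mul_nonneg hlam hr
  have h1 : Real.exp (-(lam * r)) ≤ 1 := Real.exp_le_one_iff.mpr (by linarith)
  have h2 := kernel_le_sq hx
  rw [mul_pow] at h2
  rcases min_cases r (r ^ 2) with ⟨h, -⟩ | ⟨h, -⟩ <;> rw [h]
  · nlinarith [sq_nonneg lam, mul_nonneg (sq_nonneg lam) hr]
  · nlinarith [mul_nonneg hlam (sq_nonneg r)]

lemma kernel_pos {x : ℝ} (hx : x ≠ 0) : 0 < Real.exp (-x) - 1 + x := by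
  linarith [Real.add_one_lt_exp (neg_ne_zero.mpr hx)]

variable (b : BranchingMechanism)

lemma integrable_min :
    Integrable (fun r : PosHalfLine => min (r : ℝ) ((r : ℝ) ^ 2)) b.π := by
  refine ⟨by fun_prop, ?_⟩
  rw [hasFiniteIntegral_iff_ofReal (.of_forall fun r => ?_)]
  · exact b.π_integrable
  · exact le_min (mem_Ioi.mp r.2).le (sq_nonneg _)

lemma integrable_kernel {lam : ℝ} (hlam : 0 ≤ lam) :
    Integrable (fun r : PosHalfLine => Real.exp (-(lam * (r : ℝ))) - 1 + lam * (r : ℝ)) b.π := by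
  refine (b.integrable_min.const_mul (lam + lam ^ 2)).mono' (by fun_prop) (.of_forall fun r => ?_)
  rw [Real.norm_of_nonneg (kernel_nonneg _ _)]
  exact kernel_le hlam (mem_Ioi.mp r.2).le

lemma psi_zero : b.psi 0 = 0 := by simp [psi]

lemma integral_kernel_nonneg (lam : ℝ) :
    0 ≤ ∫ r : PosHalfLine, (Real.exp (-(lam * (r : ℝ))) - 1 + lam * (r : ℝ)) ∂b.π :=
  integral_nonneg fun _ => kernel_nonneg _ _

lemma mul_le_psi (lam : ℝ) : b.α * lam ≤ b.psi lam := by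
  have := b.integral_kernel_nonneg lam
  have : 0 ≤ b.σ ^ 2 * lam ^ 2 / 2 := by positivity
  rw [psi]; linarith

lemma psi_nonneg (hα : 0 ≤ b.α) {lam : ℝ} (hlam : 0 ≤ lam) : 0 ≤ b.psi lam :=
  (mul_nonneg hα hlam).trans (b.mul_le_psi lam)

lemma convexOn_psi : ConvexOn ℝ (Ici 0) b.psi := by
  refine ⟨convex_Ici 0, fun x hx y hy s t hs ht hst => ?_⟩
  have hx : 0 ≤ x := hx
  have hy : 0 ≤ y := hy
  have hconv (r : ℝ) : Real.exp (-((s * x + t * y) * r)) - 1 + (s * x + t * y) * r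
      ≤ s * (Real.exp (-(x * r)) - 1 + x * r) + t * (Real.exp (-(y * r)) - 1 + y * r) := by
    have := convexOn_exp.2 (mem_univ (-(x * r))) (mem_univ (-(y * r))) hs ht hst
    simp only [smul_eq_mul] at this
    have h2 : s * -(x * r) + t * -(y * r) = -((s * x + t * y) * r) := by ring
    rw [h2] at this
    have h3 : t = 1 - s := by linarith
    subst h3
    linarith
  have hsq : (s * x + t * y) ^ 2 ≤ s * x ^ 2 + t * y ^ 2 := by
    have h3 : t = 1 - s := by linarith
    subst h3
    nlinarith [mul_nonneg (mul_nonneg hs ht) (sq_nonneg (x - y))]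
  have hint : ∫ r : PosHalfLine, (Real.exp (-((s * x + t * y) * (r : ℝ))) - 1
        + (s * x + t * y) * (r : ℝ)) ∂b.π
      ≤ s * (∫ r : PosHalfLine, (Real.exp (-(x * (r : ℝ))) - 1 + x * (r : ℝ)) ∂b.π)
        + t * ∫ r : PosHalfLine, (Real.exp (-(y * (r : ℝ))) - 1 + y * (r : ℝ)) ∂b.π := by
    rw [← integral_const_mul, ← integral_const_mul,
      ← integral_add ((b.integrable_kernel hx).const_mul s) ((b.integrable_kernel hy).const_mul t)]
    exact integral_mono (b.integrable_kernel (by positivity))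
      (((b.integrable_kernel hx).const_mul s).add ((b.integrable_kernel hy).const_mul t))
      fun r => hconv r
  simp only [psi, smul_eq_mul]
  have := mul_le_mul_of_nonneg_left hsq (sq_nonneg b.σ)
  linarith

/-- Chords from the origin of a convex function vanishing at `0` have increasing slope. -/
lemma psi_div_le_psi_div {u v : ℝ} (hu : 0 < u) (huv : u ≤ v) : b.psi u / u ≤ b.psi v / v := by
  have hv : 0 < v := hu.trans_le huv
  have h := b.convexOn_psi.2 (mem_Ici.mpr le_rfl) (mem_Ici.mpr hv.le)
    (sub_nonneg.mpr (div_le_one_of_le₀ huv hv.le)) (div_nonneg hu.le hv.le) (by ring)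
  simp only [smul_eq_mul, mul_zero, zero_add, b.psi_zero] at h
  rw [div_mul_cancel₀ _ hv.ne'] at h
  rw [div_le_iff₀ hu]
  calc b.psi u ≤ u / v * b.psi v := h
    _ = b.psi v / v * u := by ring

lemma continuousOn_psi : ContinuousOn b.psi (Ioi 0) :=
  ConvexOn.continuousOn isOpen_Ioi (b.convexOn_psi.subset Ioi_subset_Ici_self (convex_Ioi 0))

lemma psi_le_psi (hα : 0 ≤ b.α) {u v : ℝ} (hu : 0 < u) (huv : u ≤ v) : b.psi u ≤ b.psi v := by
  have hv : 0 < v := hu.trans_le huv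
  have h := b.psi_div_le_psi_div hu huv
  have h2 : b.psi v / v ≤ b.psi v / u :=
    div_le_div_of_nonneg_left (b.psi_nonneg hα hv.le) hu huv
  exact (div_le_div_iff_of_pos_right hu).mp (h.trans h2)

/-- Dominated convergence: the kernel over `lam` is at most `lam * r ^ 2`, and at most `2 * min r (r
^ 2)` for `lam < 1`. -/
lemma tendsto_psi_div_zero :
    Tendsto (fun lam => b.psi lam / lam) (𝓝[>] 0) (𝓝 b.α) := by
  have hpos : ∀ᶠ lam : ℝ in 𝓝[>] 0, 0 < lam := eventually_mem_nhdsWithin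
  have hone : ∀ᶠ lam : ℝ in 𝓝[>] 0, lam < 1 :=
    eventually_nhdsWithin_of_eventually_nhds (eventually_lt_nhds one_pos)
  have hid : Tendsto (fun lam : ℝ => lam) (𝓝[>] 0) (𝓝 0) := tendsto_id.mono_left nhdsWithin_le_nhds
  have hint : Tendsto (fun lam => ∫ r : PosHalfLine,
      (Real.exp (-(lam * (r : ℝ))) - 1 + lam * (r : ℝ)) / lam ∂b.π) (𝓝[>] 0)
      (𝓝 (∫ r : PosHalfLine, (0 : ℝ) ∂b.π)) := by
    refine tendsto_integral_filter_of_dominated_convergence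
      (fun r : PosHalfLine => 2 * min (r : ℝ) ((r : ℝ) ^ 2))
      (.of_forall fun lam => by fun_prop) ?_ (b.integrable_min.const_mul 2)
      (.of_forall fun r => ?_)
    · filter_upwards [hpos, hone] with lam h0 h1
      refine .of_forall fun r => ?_
      rw [Real.norm_of_nonneg (div_nonneg (kernel_nonneg _ _) h0.le), div_le_iff₀ h0]
      refine (kernel_le h0.le (mem_Ioi.mp r.2).le).trans ?_
      have : 0 ≤ min (r : ℝ) ((r : ℝ) ^ 2) := le_min (mem_Ioi.mp r.2).le (sq_nonneg _)
      nlinarith [mul_nonneg this h0.le]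
    · refine squeeze_zero' (g := fun lam => lam * (r : ℝ) ^ 2) ?_ ?_ ?_
      · filter_upwards [hpos] with lam h0
        exact div_nonneg (kernel_nonneg _ _) h0.le
      · filter_upwards [hpos] with lam h0
        rw [div_le_iff₀ h0]
        refine (kernel_le_sq (mul_nonneg h0.le (mem_Ioi.mp r.2).le)).trans (le_of_eq (by ring))
      · simpa using hid.mul_const ((r : ℝ) ^ 2)
  have h2 : Tendsto (fun lam : ℝ => b.α + b.σ ^ 2 * lam / 2 + ∫ r : PosHalfLine,
      (Real.exp (-(lam * (r : ℝ))) - 1 + lam * (r : ℝ)) / lam ∂b.π) (𝓝[>] 0)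
      (𝓝 (b.α + b.σ ^ 2 * 0 / 2 + ∫ r : PosHalfLine, (0 : ℝ) ∂b.π)) :=
    (((hid.const_mul _).div_const 2).const_add b.α).add hint
  simp only [mul_zero, zero_div, add_zero, integral_zero] at h2
  refine h2.congr' ?_
  filter_upwards [hpos] with lam h0
  rw [integral_div, psi]
  field_simp

variable {b}

lemma GreyCondition.exists_psi_pos (hG : b.GreyCondition) : ∃ lam, 0 < lam ∧ 0 < b.psi lam := by
  obtain ⟨θ, hθ, hfin⟩ := hG
  by_contra! hcon
  have : ∫⁻ lam in Ioi θ, (ENNReal.ofReal (b.psi lam))⁻¹ = ∞ := by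
    rw [setLIntegral_congr_fun (g := fun _ => ∞) measurableSet_Ioi fun lam hlam => by
      simp [ENNReal.ofReal_of_nonpos (hcon lam (hθ.trans hlam))]]
    simp
  exact hfin.ne this

/-- If `ψ` had a zero `lam > 0`, its three nonnegative terms would vanish there, forcing `α`, `σ`
and `π` to be zero and `ψ` to vanish identically, against Grey's condition. -/
lemma psi_pos (hα : 0 ≤ b.α) (hG : b.GreyCondition) {lam : ℝ} (hlam : 0 < lam) :
    0 < b.psi lam := by
  refine lt_of_le_of_ne (b.psi_nonneg hα hlam.le) fun h0 => ?_
  have h1 := b.integral_kernel_nonneg lam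
  have h2 : 0 ≤ b.σ ^ 2 * lam ^ 2 / 2 := by positivity
  have h3 : 0 ≤ b.α * lam := by positivity
  rw [psi] at h0
  have hα0 : b.α = 0 := by
    have : b.α * lam = 0 := by linarith
    simpa [hlam.ne'] using this
  have hσ0 : b.σ = 0 := by
    have : b.σ ^ 2 * lam ^ 2 / 2 = 0 := by linarith
    simpa [hlam.ne'] using this
  have hπ0 : b.π = 0 := by
    have : ∫ r : PosHalfLine, (Real.exp (-(lam * (r : ℝ))) - 1 + lam * (r : ℝ)) ∂b.π = 0 := by
      linarith
    rw [integral_eq_zero_iff_of_nonneg (fun _ => kernel_nonneg _ _)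
      (b.integrable_kernel hlam.le)] at this
    rw [← Measure.measure_univ_eq_zero]
    have h4 := ae_iff.mp this
    convert h4
    ext r
    simpa using (kernel_pos (mul_pos hlam (mem_Ioi.mp r.2)).ne').ne'
  obtain ⟨x, -, hx⟩ := hG.exists_psi_pos
  simp [psi, hα0, hσ0, hπ0] at hx

lemma GreyCondition.integrableOn_aux (hα : 0 ≤ b.α) (hG : b.GreyCondition) :
    ∃ θ, 0 < θ ∧ IntegrableOn (fun u => 1 / b.psi u) (Ioi θ) := by
  have hpos := fun {x : ℝ} (hx : 0 < x) => psi_pos hα hG hx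
  obtain ⟨θ, hθ, hfin⟩ := hG
  have hsub : Ioi θ ⊆ Ioi 0 := Ioi_subset_Ioi hθ.le
  refine ⟨θ, hθ, ?_, ?_⟩
  · refine ContinuousOn.aestronglyMeasurable ?_ measurableSet_Ioi
    exact continuousOn_const.div (b.continuousOn_psi.mono hsub) fun x hx => (hpos (hsub hx)).ne'
  · rw [hasFiniteIntegral_iff_ofReal]
    · refine lt_of_eq_of_lt (setLIntegral_congr_fun measurableSet_Ioi fun x hx => ?_) hfin
      rw [one_div, ENNReal.ofReal_inv_of_pos (hpos (hsub hx))]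
    · filter_upwards [ae_restrict_mem measurableSet_Ioi] with x hx
      exact (one_div_pos.mpr (hpos (hsub hx))).le

lemma continuousOn_one_div_psi (hα : 0 ≤ b.α) (hG : b.GreyCondition) :
    ContinuousOn (fun u => 1 / b.psi u) (Ioi 0) :=
  continuousOn_const.div b.continuousOn_psi fun _ hx => (psi_pos hα hG hx).ne'

lemma integrableOn_one_div_psi (hα : 0 ≤ b.α) (hG : b.GreyCondition) {lam : ℝ} (hlam : 0 < lam) :
    IntegrableOn (fun u => 1 / b.psi u) (Ioi lam) := by
  obtain ⟨θ, hθ, hint⟩ := hG.integrableOn_aux hα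
  have hI : IntegrableOn (fun u => 1 / b.psi u) (Icc lam θ) :=
    ((continuousOn_one_div_psi hα hG).mono fun x hx => hlam.trans_le hx.1).integrableOn_Icc
  refine (hI.union hint).mono_set fun x hx => ?_
  rcases le_or_gt x θ with h | h
  · exact Or.inl ⟨(mem_Ioi.mp hx).le, h⟩
  · exact Or.inr h

/-- The quotient is monotone; were it bounded, `1/ψ` would dominate a multiple of `1/λ`, which is
not integrable at infinity. -/
lemma tendsto_psi_div_atTop (hα : 0 ≤ b.α) (hG : b.GreyCondition) :
    Tendsto (fun lam => b.psi lam / lam) atTop atTop := by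
  rw [tendsto_atTop]
  intro C
  by_contra hcon
  have hbd : ∀ lam, 0 < lam → b.psi lam / lam ≤ max C 1 := by
    intro lam hlam
    obtain ⟨x, hx, hxC⟩ := (not_eventually.mp hcon).forall_exists_of_atTop lam
    exact (b.psi_div_le_psi_div hlam hx).trans ((not_le.mp hxC).le.trans (le_max_left _ _))
  have hC : 0 < max C 1 := lt_max_of_lt_right one_pos
  have hint := (integrableOn_one_div_psi hα hG one_pos).const_mul (max C 1)
  refine not_integrableOn_Ioi_inv (a := 1) (hint.mono' (by fun_prop) ?_)
  filter_upwards [ae_restrict_mem measurableSet_Ioi] with x hx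
  have hx0 : 0 < x := one_pos.trans hx
  have := hbd x hx0
  have hp := psi_pos hα hG hx0
  rw [div_le_iff₀ hx0] at this
  rw [Real.norm_of_nonneg (inv_nonneg.mpr hx0.le), mul_one_div, le_div_iff₀ hp, inv_mul_le_iff₀ hx0]
  linarith

end BranchingMechanism

namespace BranchingMechanism

/-! ### The functions `φ` and `φ⁻¹` -/

variable {b : BranchingMechanism}

lemma phi_sub_phi (hα : 0 ≤ b.α) (hG : b.GreyCondition) {a c : ℝ} (ha : 0 < a) (hac : a ≤ c) :
    b.phi a - b.phi c = ∫ u in a..c, 1 / b.psi u := by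
  have hI := integrableOn_one_div_psi hα hG ha
  rw [phi, phi, intervalIntegral.integral_of_le hac, ← Ioc_union_Ioi_eq_Ioi hac,
    setIntegral_union (Ioc_disjoint_Ioi le_rfl) measurableSet_Ioi (hI.mono_set Ioc_subset_Ioi_self)
      (hI.mono_set (Ioi_subset_Ioi hac))]
  ring

lemma intervalIntegrable_one_div_psi (hα : 0 ≤ b.α) (hG : b.GreyCondition) {a c : ℝ} (ha : 0 < a)
    (hac : a ≤ c) : IntervalIntegrable (fun u => 1 / b.psi u) volume a c :=
  ((continuousOn_one_div_psi hα hG).mono fun x hx => by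
    rw [uIcc_of_le hac] at hx
    exact ha.trans_le hx.1).intervalIntegrable

lemma phi_sub_phi_le (hα : 0 ≤ b.α) (hG : b.GreyCondition) {w q : ℝ} (hw : 0 < w) (hwq : w ≤ q) :
    b.phi w - b.phi q ≤ (q - w) / b.psi w := by
  rw [phi_sub_phi hα hG hw hwq]
  calc ∫ u in w..q, 1 / b.psi u ≤ ∫ u in w..q, 1 / b.psi w := by
        refine intervalIntegral.integral_mono_on hwq (intervalIntegrable_one_div_psi hα hG hw hwq)
          intervalIntegrable_const fun u hu => ?_
        exact one_div_le_one_div_of_le (psi_pos hα hG hw) (b.psi_le_psi hα hw hu.1)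
    _ = (q - w) / b.psi w := by
        rw [intervalIntegral.integral_const, smul_eq_mul, mul_one_div]

lemma le_phi_sub_phi (hα : 0 ≤ b.α) (hG : b.GreyCondition) {w q : ℝ} (hw : 0 < w) (hwq : w ≤ q) :
    (q - w) / b.psi q ≤ b.phi w - b.phi q := by
  rw [phi_sub_phi hα hG hw hwq]
  calc (q - w) / b.psi q = ∫ u in w..q, 1 / b.psi q := by
        rw [intervalIntegral.integral_const, smul_eq_mul, mul_one_div]
    _ ≤ ∫ u in w..q, 1 / b.psi u := by
        refine intervalIntegral.integral_mono_on hwq intervalIntegrable_const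
          (intervalIntegrable_one_div_psi hα hG hw hwq) fun u hu => ?_
        have hu0 := hw.trans_le hu.1
        exact one_div_le_one_div_of_le (psi_pos hα hG hu0) (b.psi_le_psi hα hu0 hu.2)

lemma intervalIntegrable_one_div {w q : ℝ} (hw : 0 < w) (hwq : w ≤ q) :
    IntervalIntegrable (fun u : ℝ => 1 / u) volume w q :=
  (continuousOn_const.div continuousOn_id fun x hx => by
    rw [uIcc_of_le hwq] at hx
    exact (hw.trans_le hx.1).ne').intervalIntegrable

/-- Integrate `1/u ≤ (ψ(q)/q) / ψ(u)` over `[w, q]`. With the reverse bound from `α u ≤ ψ(u)`, this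
controls the ratio `q/w` by the time `φ(w) - φ(q)`. -/
lemma log_div_le_phi_sub_phi (hα : 0 ≤ b.α) (hG : b.GreyCondition) {w q : ℝ} (hw : 0 < w)
    (hwq : w ≤ q) : Real.log (q / w) ≤ b.psi q / q * (b.phi w - b.phi q) := by
  have hq := hw.trans_le hwq
  rw [phi_sub_phi hα hG hw hwq, ← integral_one_div_of_pos hw hq,
    ← intervalIntegral.integral_const_mul]
  refine intervalIntegral.integral_mono_on hwq (intervalIntegrable_one_div hw hwq)
    ((intervalIntegrable_one_div_psi hα hG hw hwq).const_mul _) fun u hu => ?_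
  have hu0 := hw.trans_le hu.1
  have hp := psi_pos hα hG hu0
  have := b.psi_div_le_psi_div hu0 hu.2
  rw [mul_one_div, le_div_iff₀ hp, one_div_mul_eq_div]
  exact this

lemma mul_phi_sub_phi_le_log (hα : 0 ≤ b.α) (hG : b.GreyCondition) {w q : ℝ} (hw : 0 < w)
    (hwq : w ≤ q) : b.α * (b.phi w - b.phi q) ≤ Real.log (q / w) := by
  have hq := hw.trans_le hwq
  rw [phi_sub_phi hα hG hw hwq, ← integral_one_div_of_pos hw hq,
    ← intervalIntegral.integral_const_mul]
  refine intervalIntegral.integral_mono_on hwq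
    ((intervalIntegrable_one_div_psi hα hG hw hwq).const_mul _)
    (intervalIntegrable_one_div hw hwq) fun u hu => ?_
  have hu0 := hw.trans_le hu.1
  have hp := psi_pos hα hG hu0
  have := b.mul_le_psi u
  rw [mul_one_div, div_le_div_iff₀ hp hu0, one_mul]
  exact this

lemma strictAntiOn_phi (hα : 0 ≤ b.α) (hG : b.GreyCondition) : StrictAntiOn b.phi (Ioi 0) := by
  intro w hw q hq hwq
  have h1 := le_phi_sub_phi hα hG hw hwq.le
  have h2 : 0 < (q - w) / b.psi q := div_pos (sub_pos.mpr hwq) (psi_pos hα hG hq)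
  linarith

lemma hasDerivAt_phi (hα : 0 ≤ b.α) (hG : b.GreyCondition) {x : ℝ} (hx : 0 < x) :
    HasDerivAt b.phi (-(1 / b.psi x)) x := by
  have hx2 : 0 < x / 2 := by linarith
  have hcont := continuousOn_one_div_psi hα hG
  have h1 : HasDerivAt (fun y => ∫ u in (x / 2)..y, 1 / b.psi u) (1 / b.psi x) x :=
    intervalIntegral.integral_hasDerivAt_right
      (intervalIntegrable_one_div_psi hα hG hx2 (by linarith))
      (hcont.stronglyMeasurableAtFilter isOpen_Ioi x hx)
      (hcont.continuousAt (Ioi_mem_nhds hx))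
  refine (h1.const_sub (b.phi (x / 2))).congr_of_eventuallyEq ?_
  filter_upwards [Ioi_mem_nhds (half_lt_self hx)] with y hy
  rw [← phi_sub_phi hα hG hx2 (mem_Ioi.mp hy).le]
  ring

lemma tendsto_phi_atTop (hα : 0 ≤ b.α) (hG : b.GreyCondition) :
    Tendsto b.phi atTop (𝓝 0) := by
  have h1 := intervalIntegral_tendsto_integral_Ioi 1 (integrableOn_one_div_psi hα hG one_pos)
    tendsto_id
  have h2 := h1.const_sub (b.phi 1)
  rw [← phi, sub_self] at h2
  refine h2.congr' ?_
  filter_upwards [eventually_ge_atTop 1] with x hx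
  rw [id, ← phi_sub_phi hα hG one_pos hx]
  ring

lemma phi_pos (hα : 0 ≤ b.α) (hG : b.GreyCondition) {x : ℝ} (hx : 0 < x) : 0 < b.phi x := by
  have h1 : b.phi (x + 1) < b.phi x :=
    strictAntiOn_phi hα hG hx (mem_Ioi.mpr (by linarith)) (by linarith)
  have h2 : 0 ≤ b.phi (x + 1) := by
    refine le_of_tendsto (tendsto_phi_atTop hα hG) ?_
    filter_upwards [eventually_ge_atTop (x + 1)] with y hy
    have hx1 : 0 < x + 1 := by linarith
    exact (strictAntiOn_phi hα hG).antitoneOn hx1 (hx1.trans_le hy) hy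
  linarith

lemma tendsto_phi_zero (hα : 0 ≤ b.α) (hG : b.GreyCondition) :
    Tendsto b.phi (𝓝[>] 0) atTop := by
  have hp := psi_pos hα hG one_pos
  have h1 : Tendsto (fun w => -Real.log w / b.psi 1) (𝓝[>] 0) atTop :=
    (tendsto_neg_atBot_atTop.comp Real.tendsto_log_nhdsGT_zero).atTop_div_const hp
  refine tendsto_atTop_mono' _ ?_ h1
  filter_upwards [eventually_mem_nhdsWithin,
    eventually_nhdsWithin_of_eventually_nhds (eventually_lt_nhds one_pos)] with w hw hw1
  have h2 := log_div_le_phi_sub_phi hα hG hw hw1.le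
  have h3 := phi_pos hα hG one_pos
  rw [one_div, Real.log_inv, div_one] at h2
  rw [div_le_iff₀ hp]
  nlinarith

lemma exists_phi_eq (hα : 0 ≤ b.α) (hG : b.GreyCondition) {t : ℝ} (ht : 0 < t) :
    ∃ x ∈ Ioi (0 : ℝ), b.phi x = t := by
  obtain ⟨x, hxt, hx⟩ := (((tendsto_phi_atTop hα hG).eventually_le_const ht).and
    (eventually_gt_atTop 0)).exists
  obtain ⟨y, hyt, hy⟩ := (((tendsto_phi_zero hα hG).eventually_ge_atTop t).and
    eventually_mem_nhdsWithin).exists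
  have hcont : ContinuousOn b.phi (Ioi 0) :=
    fun z hz => (hasDerivAt_phi hα hG hz).continuousAt.continuousWithinAt
  exact isPreconnected_Ioi.intermediate_value hx hy hcont ⟨hxt, hyt⟩

lemma phiInv_pos (hα : 0 ≤ b.α) (hG : b.GreyCondition) {t : ℝ} (ht : 0 < t) : 0 < b.phiInv t :=
  Function.invFunOn_mem (exists_phi_eq hα hG ht)

lemma phi_phiInv (hα : 0 ≤ b.α) (hG : b.GreyCondition) {t : ℝ} (ht : 0 < t) :
    b.phi (b.phiInv t) = t :=
  Function.invFunOn_eq (exists_phi_eq hα hG ht)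

lemma phiInv_phi (hα : 0 ≤ b.α) (hG : b.GreyCondition) {x : ℝ} (hx : 0 < x) :
    b.phiInv (b.phi x) = x :=
  (strictAntiOn_phi hα hG).injOn (phiInv_pos hα hG (phi_pos hα hG hx)) hx
    (phi_phiInv hα hG (phi_pos hα hG hx))

lemma phiInv_lt_iff (hα : 0 ≤ b.α) (hG : b.GreyCondition) {t x : ℝ} (ht : 0 < t) (hx : 0 < x) :
    b.phiInv t < x ↔ b.phi x < t := by
  have := (strictAntiOn_phi hα hG).lt_iff_gt hx (phiInv_pos hα hG ht)
  rw [phi_phiInv hα hG ht] at this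
  exact this.symm

lemma phiInv_lt_phiInv (hα : 0 ≤ b.α) (hG : b.GreyCondition) {s t : ℝ} (hs : 0 < s) (hst : s < t) :
    b.phiInv t < b.phiInv s := by
  rw [phiInv_lt_iff hα hG (hs.trans hst) (phiInv_pos hα hG hs), phi_phiInv hα hG hs]
  exact hst

lemma tendsto_phiInv_atTop (hα : 0 ≤ b.α) (hG : b.GreyCondition) :
    Tendsto b.phiInv atTop (𝓝[>] 0) := by
  refine tendsto_nhdsWithin_iff.mpr ⟨?_, ?_⟩
  · rw [tendsto_order]
    constructor
    · intro a ha
      filter_upwards [eventually_gt_atTop 0] with t ht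
      exact ha.trans (phiInv_pos hα hG ht)
    · intro a ha
      filter_upwards [eventually_gt_atTop 0, eventually_gt_atTop (b.phi a)] with t ht hta
      exact (phiInv_lt_iff hα hG ht ha).mpr hta
  · filter_upwards [eventually_gt_atTop 0] with t ht
    exact phiInv_pos hα hG ht

/-- The increment bound `le_phi_sub_phi` gives an explicit squeeze, so continuity of `φ⁻¹` is not
needed. -/
lemma tendsto_phiInv_add_phi (hα : 0 ≤ b.α) (hG : b.GreyCondition) {t : ℝ} (ht : 0 < t) :
    Tendsto (fun lam => b.phiInv (t + b.phi lam)) atTop (𝓝 (b.phiInv t)) := by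
  have hq := phiInv_pos hα hG ht
  have hlow : Tendsto (fun lam => b.phiInv t - b.phi lam * b.psi (b.phiInv t)) atTop
      (𝓝 (b.phiInv t)) := by
    simpa using ((tendsto_phi_atTop hα hG).mul_const (b.psi (b.phiInv t))).const_sub (b.phiInv t)
  refine tendsto_of_tendsto_of_tendsto_of_le_of_le' hlow tendsto_const_nhds ?_ ?_
  all_goals
    filter_upwards [eventually_gt_atTop 0] with lam hlam
    have hs := phi_pos hα hG hlam
    have hw := phiInv_pos hα hG (add_pos ht hs)
    have hlt := phiInv_lt_phiInv hα hG ht (lt_add_of_pos_right t hs)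
  · have h := le_phi_sub_phi hα hG hw hlt.le
    rw [phi_phiInv hα hG (add_pos ht hs), phi_phiInv hα hG ht,
      div_le_iff₀ (psi_pos hα hG hq)] at h
    linarith
  · exact hlt.le

/-! ### The cumulant semigroup -/

/-- `φ(v_s) - s` has zero derivative as long as `v > 0`. Positivity is a Gronwall argument: `v`
decreases from `lam`, so `ψ(v) ≤ C v` with `C = ψ(lam)/lam`, and `v_s exp(C s)` is nondecreasing. -/
lemma IsCumulant.eq_phiInv (hα : 0 ≤ b.α) (hG : b.GreyCondition) {lam : ℝ} (hlam : 0 < lam)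
    {v : ℝ → ℝ} (hv : b.IsCumulant lam v) {t : ℝ} (ht : 0 ≤ t) :
    v t = b.phiInv (t + b.phi lam) := by
  obtain ⟨hv0, hv⟩ := hv
  have hcont : ContinuousOn v (Ici 0) := fun s hs => (hv s hs).2.continuousWithinAt
  have hanti : AntitoneOn v (Ici 0) := by
    refine antitoneOn_of_hasDerivWithinAt_nonpos (f' := fun s => -b.psi (v s)) (convex_Ici 0) hcont
      (fun s hs => (hv s (interior_subset hs)).2.mono interior_subset) fun s hs => ?_
    exact neg_nonpos.mpr (b.psi_nonneg hα (hv s (interior_subset hs)).1)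
  have hle (s : ℝ) (hs : 0 ≤ s) : v s ≤ lam := hv0 ▸ hanti (mem_Ici.mpr le_rfl) hs hs
  set C := b.psi lam / lam with hC
  have hCv (s : ℝ) (hs : 0 ≤ s) : b.psi (v s) ≤ C * v s := by
    rcases (hv s hs).1.eq_or_lt with h0 | h0
    · rw [← h0, b.psi_zero, mul_zero]
    · exact (div_le_iff₀ h0).mp (b.psi_div_le_psi_div h0 (hle s hs))
  have hmono : MonotoneOn (fun s => v s * Real.exp (C * s)) (Ici 0) := by
    have hexp (s : ℝ) : HasDerivAt (fun s => Real.exp (C * s)) (Real.exp (C * s) * C) s := by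
      simpa using ((hasDerivAt_id s).const_mul C).exp
    refine monotoneOn_of_hasDerivWithinAt_nonneg
      (f' := fun s => -b.psi (v s) * Real.exp (C * s) + v s * (Real.exp (C * s) * C))
      (convex_Ici 0) (hcont.mul (by fun_prop)) (fun s hs => ?_) fun s hs => ?_
    · exact ((hv s (interior_subset hs)).2.mono interior_subset).mul (hexp s).hasDerivWithinAt
    · have := mul_le_mul_of_nonneg_right (hCv s (interior_subset hs)) (Real.exp_pos (C * s)).le
      linarith
  have hpos (s : ℝ) (hs : 0 ≤ s) : 0 < v s := by
    have h1 := hmono (mem_Ici.mpr le_rfl) (mem_Ici.mpr hs) hs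
    simp only [mul_zero, Real.exp_zero, mul_one, hv0] at h1
    exact pos_of_mul_pos_left (hlam.trans_le h1) (Real.exp_pos _).le
  have hderiv (s : ℝ) (hs : 0 ≤ s) :
      HasDerivWithinAt (fun s => b.phi (v s) - s) 0 (Ici 0) s := by
    have h1 := (hasDerivAt_phi hα hG (hpos s hs)).comp_hasDerivWithinAt s (hv s hs).2
    have h2 := h1.sub (hasDerivWithinAt_id s (Ici 0))
    refine h2.congr_deriv ?_
    have := (psi_pos hα hG (hpos s hs)).ne'
    field_simp
    ring
  have hconst := constant_of_has_deriv_right_zero (f := fun s => b.phi (v s) - s) (a := 0) (b := t)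
    (fun s hs => ((hderiv s hs.1).continuousWithinAt).mono Icc_subset_Ici_self)
    (fun s hs => (hderiv s hs.1).mono (Ici_subset_Ici.mpr hs.1)) t ⟨ht, le_rfl⟩
  simp only [hv0, sub_zero] at hconst
  rw [show t + b.phi lam = b.phi (v t) by linarith, phiInv_phi hα hG (hpos t ht)]

/-! ### Asymptotics of the cumulant semigroup -/

lemma tendsto_psi_div_phiInv (hα : 0 ≤ b.α) (hG : b.GreyCondition) :
    Tendsto (fun t => b.psi (b.phiInv t) / b.phiInv t) atTop (𝓝 b.α) :=
  b.tendsto_psi_div_zero.comp (tendsto_phiInv_atTop hα hG)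

/-- For `q = φ⁻¹(t)` and `w = φ⁻¹(t + s)`, `log(q/w)` lies between `α s` and `s ψ(q)/q`, which tends
to `α s`. -/
lemma tendsto_phiInv_sub_div_subcritical (hα : 0 < b.α) (hG : b.GreyCondition) {s : ℝ}
    (hs : 0 < s) :
    Tendsto (fun t => (b.phiInv t - b.phiInv (t + s)) / b.psi (b.phiInv t)) atTop
      (𝓝 ((1 - Real.exp (-(b.α * s))) / b.α)) := by
  have hlog : Tendsto (fun t => Real.log (b.phiInv t / b.phiInv (t + s))) atTop (𝓝 (b.α * s)) := by
    refine tendsto_of_tendsto_of_tendsto_of_le_of_le' tendsto_const_nhds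
      ((tendsto_psi_div_phiInv hα.le hG).mul_const s) ?_ ?_
    all_goals
      filter_upwards [eventually_gt_atTop 0] with t ht
      have hw := phiInv_pos hα.le hG (add_pos ht hs)
      have hlt := phiInv_lt_phiInv hα.le hG ht (lt_add_of_pos_right t hs)
      have hd : b.phi (b.phiInv (t + s)) - b.phi (b.phiInv t) = s := by
        rw [phi_phiInv hα.le hG (add_pos ht hs), phi_phiInv hα.le hG ht]; ring
    · have := mul_phi_sub_phi_le_log hα.le hG hw hlt.le
      rwa [hd] at this
    · have := log_div_le_phi_sub_phi hα.le hG hw hlt.le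
      rwa [hd] at this
  have h1 := ((Real.continuous_exp.tendsto _).comp hlog.neg).const_sub 1
  have h2 := h1.div (tendsto_psi_div_phiInv hα.le hG) hα.ne'
  refine h2.congr' ?_
  filter_upwards [eventually_gt_atTop 0] with t ht
  have hw := phiInv_pos hα.le hG (add_pos ht hs)
  have hq := phiInv_pos hα.le hG ht
  have hp := psi_pos hα.le hG hq
  simp only [Function.comp_apply, Pi.div_apply]
  rw [← Real.log_inv, Real.exp_log (by positivity)]
  field_simp

/-- For `q = φ⁻¹(t)` and `w = φ⁻¹(t + s)`, monotonicity of `ψ` gives `s ψ(w) ≤ q - w ≤ s ψ(q)`. It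
remains to see that `ψ(w)/ψ(q) → 1`, which holds because the slope of `ψ` near `0` tends to `α = 0`.
-/
lemma tendsto_phiInv_sub_div_critical (hα : b.α = 0) (hG : b.GreyCondition) {s : ℝ}
    (hs : 0 < s) :
    Tendsto (fun t => (b.phiInv t - b.phiInv (t + s)) / b.psi (b.phiInv t)) atTop (𝓝 s) := by
  have hα' : 0 ≤ b.α := hα.ge
  have h2q : Tendsto (fun t => 2 * b.phiInv t) atTop (𝓝[>] 0) := by
    refine tendsto_nhdsWithin_iff.mpr ⟨?_, ?_⟩
    · simpa using ((tendsto_phiInv_atTop hα' hG).mono_right nhdsWithin_le_nhds).const_mul 2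
    · filter_upwards [eventually_gt_atTop 0] with t ht
      exact mul_pos two_pos (phiInv_pos hα' hG ht)
  have h1 : Tendsto (fun t => s * (1 - s * (2 * (b.psi (2 * b.phiInv t) / (2 * b.phiInv t)))))
      atTop (𝓝 s) := by
    have := (((b.tendsto_psi_div_zero.comp h2q).const_mul 2).const_mul s).const_sub 1
    simpa [hα] using this.const_mul s
  refine tendsto_of_tendsto_of_tendsto_of_le_of_le' h1 tendsto_const_nhds ?_ ?_
  all_goals
    filter_upwards [eventually_gt_atTop 0] with t ht
    have hw := phiInv_pos hα' hG (add_pos ht hs)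
    have hq := phiInv_pos hα' hG ht
    have hlt := phiInv_lt_phiInv hα' hG ht (lt_add_of_pos_right t hs)
    have hd : b.phi (b.phiInv (t + s)) - b.phi (b.phiInv t) = s := by
      rw [phi_phiInv hα' hG (add_pos ht hs), phi_phiInv hα' hG ht]; ring
    have hup := le_phi_sub_phi hα' hG hw hlt.le
    rw [hd] at hup
  · have hlo := phi_sub_phi_le hα' hG hw hlt.le
    rw [hd] at hlo
    set q := b.phiInv t
    set w := b.phiInv (t + s)
    have hpq := psi_pos hα' hG hq
    have hpw := psi_pos hα' hG hw
    -- By convexity the slope on `[w, q]` is at most that on `[q, 2q]`, hence at most `ψ(2q)/q`;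
    -- this replaces a bound on `ψ'(q)`.
    have hslope := b.convexOn_psi.slope_mono_adjacent (mem_Ici.mpr hw.le)
      (mem_Ici.mpr (mul_pos two_pos hq).le) hlt (by linarith : q < 2 * q)
    have h2 : b.psi q - b.psi w ≤ b.psi (2 * q) / q * (q - w) := by
      rw [div_le_iff₀ (sub_pos.mpr hlt)] at hslope
      refine hslope.trans (mul_le_mul_of_nonneg_right ?_ (sub_pos.mpr hlt).le)
      rw [show 2 * q - q = q by ring]
      exact (div_le_div_iff_of_pos_right hq).mpr (by linarith)
    rw [le_div_iff₀ hpw] at hlo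
    rw [div_le_iff₀ hpq] at hup
    have h3 : 0 ≤ b.psi (2 * q) / q := div_nonneg (b.psi_nonneg hα' (by linarith)) hq.le
    have h4 : b.psi q - b.psi w ≤ b.psi (2 * q) / q * (s * b.psi q) :=
      h2.trans (mul_le_mul_of_nonneg_left hup h3)
    have h5 : 2 * (b.psi (2 * q) / (2 * q)) = b.psi (2 * q) / q := by field_simp
    rw [h5, le_div_iff₀ hpq]
    have h6 := mul_le_mul_of_nonneg_left h4 hs.le
    nlinarith
  · exact hup

lemma tendsto_one_sub_exp_div : Tendsto (fun z : ℝ => (1 - Real.exp (-z)) / z) (𝓝[>] 0) (𝓝 1) := by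
  have h := (Real.hasDerivAt_exp 0).tendsto_slope_zero_left
  have hneg : Tendsto (fun z : ℝ => -z) (𝓝[>] 0) (𝓝[<] 0) := by
    simpa using tendsto_neg_nhdsGT (a := (0 : ℝ))
  have h2 := h.comp hneg
  rw [Real.exp_zero] at h2
  refine h2.congr fun z => ?_
  simp only [Function.comp_apply, zero_add, smul_eq_mul]
  rw [inv_neg, div_eq_inv_mul]
  ring

/-- The normalised Laplace transform of the transition probabilities has the same limit as the
normalised increments of `φ⁻¹`. -/
lemma tendsto_exp_sub_exp_div (hα : 0 ≤ b.α) (hG : b.GreyCondition) {s x c : ℝ} (hs : 0 < s)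
    (hx : 0 < x)
    (h : Tendsto (fun t => (b.phiInv t - b.phiInv (t + s)) / b.psi (b.phiInv t)) atTop (𝓝 c)) :
    Tendsto (fun t => (Real.exp (-(x * b.phiInv (t + s))) - Real.exp (-(x * b.phiInv t)))
      / (x * b.psi (b.phiInv t))) atTop (𝓝 c) := by
  have hq0 : Tendsto b.phiInv atTop (𝓝 0) :=
    (tendsto_phiInv_atTop hα hG).mono_right nhdsWithin_le_nhds
  have hw0 : Tendsto (fun t => b.phiInv (t + s)) atTop (𝓝 0) :=
    hq0.comp (tendsto_atTop_add_const_right _ s tendsto_id)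
  have hz : Tendsto (fun t => x * (b.phiInv t - b.phiInv (t + s))) atTop (𝓝[>] 0) := by
    refine tendsto_nhdsWithin_iff.mpr ⟨by simpa using (hq0.sub hw0).const_mul x, ?_⟩
    filter_upwards [eventually_gt_atTop 0] with t ht
    exact mul_pos hx (sub_pos.mpr (phiInv_lt_phiInv hα hG ht (lt_add_of_pos_right t hs)))
  have h1 := tendsto_one_sub_exp_div.comp hz
  have h2 : Tendsto (fun t => Real.exp (-(x * b.phiInv (t + s)))) atTop (𝓝 1) := by
    have := (Real.continuous_exp.tendsto _).comp (hw0.const_mul x).neg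
    simpa [Function.comp_def] using this
  have h3 := (h2.mul h1).mul h
  rw [one_mul, one_mul] at h3
  refine h3.congr' ?_
  filter_upwards [eventually_gt_atTop 0] with t ht
  have hlt := phiInv_lt_phiInv hα hG ht (lt_add_of_pos_right t hs)
  have hp := (psi_pos hα hG (phiInv_pos hα hG ht)).ne'
  have hd : b.phiInv t - b.phiInv (t + s) ≠ 0 := (sub_pos.mpr hlt).ne'
  have he : Real.exp (-(x * b.phiInv t)) = Real.exp (-(x * b.phiInv (t + s)))
      * Real.exp (-(x * (b.phiInv t - b.phiInv (t + s)))) := by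
    rw [← Real.exp_add]; congr 1; ring
  simp only [Function.comp_apply]
  rw [he]
  field_simp

lemma tendsto_one_sub_exp_phiInv_div (hα : 0 < b.α) (hG : b.GreyCondition) {x : ℝ} (hx : 0 < x) :
    Tendsto (fun t => (1 - Real.exp (-(x * b.phiInv t))) / (x * b.psi (b.phiInv t))) atTop
      (𝓝 (1 / b.α)) := by
  have hq := tendsto_phiInv_atTop hα.le hG
  have hz : Tendsto (fun t => x * b.phiInv t) atTop (𝓝[>] 0) := by
    refine tendsto_nhdsWithin_iff.mpr
      ⟨by simpa using (hq.mono_right nhdsWithin_le_nhds).const_mul x, ?_⟩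
    filter_upwards [eventually_gt_atTop 0] with t ht
    exact mul_pos hx (phiInv_pos hα.le hG ht)
  have h := (tendsto_one_sub_exp_div.comp hz).div (tendsto_psi_div_phiInv hα.le hG) hα.ne'
  refine h.congr' ?_
  filter_upwards [eventually_gt_atTop 0] with t ht
  have h1 := (phiInv_pos hα.le hG ht).ne'
  have h2 := (psi_pos hα.le hG (phiInv_pos hα.le hG ht)).ne'
  simp only [Function.comp_apply, Pi.div_apply]
  field_simp

end BranchingMechanism

/-! ### Laws of continuous-state branching processes -/

section Laws

variable {Ω : Type*} [MeasurableSpace Ω] {b : BranchingMechanism} {Pr : Kernel ℝ≥0 Ω}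
  {Z : ℝ≥0 → Ω → ℝ≥0}

lemma lawOnPos_apply (m : Measure Ω) {t : ℝ≥0} (hZ : Measurable (Z t)) {A : Set PosHalfLine}
    (hA : MeasurableSet A) :
    lawOnPos m Z t A = m {ω | ∃ y ∈ A, (y : ℝ) = Z t ω} := by
  have hemb := MeasurableEmbedding.subtype_coe (measurableSet_Ioi (a := (0 : ℝ)))
  rw [lawOnPos, hemb.comap_apply, Measure.map_apply (by fun_prop) (hemb.measurableSet_image.mpr hA)]
  rfl

lemma map_val_lawOnPos (m : Measure Ω) (t : ℝ≥0) :
    (lawOnPos m Z t).map Subtype.val = (m.map fun ω => (Z t ω : ℝ)).restrict (Ioi 0) := by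
  rw [lawOnPos, (MeasurableEmbedding.subtype_coe (measurableSet_Ioi (a := (0 : ℝ)))).map_comap,
    Subtype.range_coe]

lemma laplacePos_lawOnPos (m : Measure Ω) {t : ℝ≥0} (hZ : Measurable (Z t)) (lam : ℝ) :
    laplacePos (lawOnPos m Z t) lam
      = ∫⁻ ω in {ω | Z t ω ≠ 0}, ENNReal.ofReal (Real.exp (-(lam * (Z t ω : ℝ)))) ∂m := by
  rw [← laplace_map_val, map_val_lawOnPos, laplace, Measure.restrict_map (by fun_prop)
    measurableSet_Ioi, lintegral_map (by fun_prop) (by fun_prop)]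
  congr 2
  ext ω
  simp [pos_iff_ne_zero]

lemma lawOnPos_univ (m : Measure Ω) {t : ℝ≥0} (hZ : Measurable (Z t)) :
    lawOnPos m Z t univ = m {ω | Z t ω ≠ 0} := by
  rw [← laplacePos_zero, laplacePos_lawOnPos m hZ]
  simp

lemma lawOnPos_smul (c : ℝ≥0∞) (m : Measure Ω) {t : ℝ≥0} (hZ : Measurable (Z t)) :
    lawOnPos (c • m) Z t = c • lawOnPos m Z t := by
  ext A hA
  simp [lawOnPos_apply _ hZ hA]

namespace IsCBProcess

lemma measurable_apply (h : IsCBProcess b Pr Z) (t : ℝ≥0) : Measurable (Z t) :=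
  (h.measurable t).measurable

/-- Up to time `t` the process survives if and only if it does not vanish at time `t`. -/
lemma survival_eq (h : IsCBProcess b Pr Z) (t : ℝ≥0) : survival Z t = {ω | Z t ω ≠ 0} := by
  ext ω
  simp only [survival, mem_ofPred_eq, extinctionTime]
  constructor
  · intro hlt h0
    -- Times `a > t` are used because the infimum defining `ζ` excludes time `0`, while `t = 0` is
    -- allowed here.
    refine hlt.not_ge (le_of_forall_gt_imp_ge_of_dense fun a ha => ?_)
    rcases eq_or_ne a ∞ with rfl | ha'
    · exact le_top
    lift a to ℝ≥0 using ha'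
    have hta : t < a := by exact_mod_cast ha
    exact iInf₂_le a ⟨pos_of_gt hta, h.absorbed ω t a hta.le h0⟩
  · intro h0
    -- Right continuity keeps the path away from `0` for a while after `t`, which makes `t < ζ`
    -- strict.
    have hev : ∀ᶠ s in 𝓝[≥] t, Z s ω ≠ 0 :=
      (h.rightContinuous ω t).eventually (isOpen_ne.mem_nhds h0)
    obtain ⟨u, hu, hsub⟩ := (mem_nhdsGE_iff_exists_Ico_subset).mp hev
    have hu : t < u := hu
    refine lt_of_lt_of_le (ENNReal.coe_lt_coe.mpr hu) (le_iInf₂ fun s hs => ?_)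
    refine ENNReal.coe_le_coe.mpr (le_of_not_gt fun hsu => ?_)
    rcases le_total s t with hst | hst
    · exact h0 (h.absorbed ω s t hst hs.2)
    · exact hsub ⟨hst, hsu⟩ hs.2

lemma lawOnPos_cond (h : IsCBProcess b Pr Z) (m : Measure Ω) (t : ℝ≥0) :
    lawOnPos (m[|survival Z t]) Z t = (lawOnPos m Z t univ)⁻¹ • lawOnPos m Z t := by
  have hZ := h.measurable_apply t
  rw [lawOnPos_univ _ hZ, ProbabilityTheory.cond, lawOnPos_smul _ _ hZ, h.survival_eq]
  congr 1
  ext A hA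
  rw [lawOnPos_apply _ hZ hA, lawOnPos_apply _ hZ hA, Measure.restrict_apply']
  · congr 1
    ext ω
    simp only [mem_inter_iff, mem_ofPred_eq, and_iff_left_iff_imp]
    rintro ⟨y, -, hy⟩ h0
    rw [h0] at hy
    exact (mem_Ioi.mp y.2).ne' (by simpa using hy)
  · exact (measurableSet_singleton 0).compl.preimage hZ

lemma integral_exp (h : IsCBProcess b Pr Z) (hα : 0 ≤ b.α) (hG : b.GreyCondition) {lam : ℝ}
    (hlam : 0 < lam) (x t : ℝ≥0) :
    ∫ ω, Real.exp (-(lam * (Z t ω : ℝ))) ∂Pr x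
      = Real.exp (-((x : ℝ) * b.phiInv (t + b.phi lam))) := by
  obtain ⟨u, hu, hint⟩ := h.logLaplace lam hlam
  rw [hint, hu.eq_phiInv hα hG hlam t.coe_nonneg]

lemma lintegral_exp (h : IsCBProcess b Pr Z) (hα : 0 ≤ b.α) (hG : b.GreyCondition) {lam : ℝ}
    (hlam : 0 < lam) (x t : ℝ≥0) :
    ∫⁻ ω, ENNReal.ofReal (Real.exp (-(lam * (Z t ω : ℝ)))) ∂Pr x
      = ENNReal.ofReal (Real.exp (-((x : ℝ) * b.phiInv (t + b.phi lam)))) := by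
  have := h.isMarkovKernel
  have hZ := h.measurable_apply t
  rw [← h.integral_exp hα hG hlam, ofReal_integral_eq_lintegral_ofReal]
  · refine (integrable_const (1 : ℝ)).mono' (by fun_prop) (.of_forall fun ω => ?_)
    rw [Real.norm_of_nonneg (Real.exp_pos _).le, Real.exp_le_one_iff]
    have := mul_nonneg hlam.le (Z t ω).coe_nonneg
    linarith
  · exact .of_forall fun ω => (Real.exp_pos _).le

/-- Let `λ = n → ∞`: `exp(-n Z_t)` tends to the indicator of `Z_t = 0`, and `φ(n) → 0`. -/
lemma measure_eq_zero (h : IsCBProcess b Pr Z) (hα : 0 ≤ b.α) (hG : b.GreyCondition)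
    (x : ℝ≥0) {t : ℝ≥0} (ht : 0 < t) :
    Pr x {ω | Z t ω = 0} = ENNReal.ofReal (Real.exp (-((x : ℝ) * b.phiInv t))) := by
  have := h.isMarkovKernel
  have hZ := h.measurable_apply t
  have hmeas : MeasurableSet {ω | Z t ω = 0} := (measurableSet_singleton 0).preimage hZ
  have h1 : Tendsto (fun n : ℕ => ∫⁻ ω, ENNReal.ofReal (Real.exp (-((n : ℝ) * (Z t ω : ℝ)))) ∂Pr x)
      atTop (𝓝 (∫⁻ ω, {ω | Z t ω = 0}.indicator 1 ω ∂Pr x)) := by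
    refine tendsto_lintegral_of_dominated_convergence (fun _ => 1) (fun n => by fun_prop)
      (fun n => .of_forall fun ω => ?_) (by simp) (.of_forall fun ω => ?_)
    · rw [← ENNReal.ofReal_one]
      refine ENNReal.ofReal_le_ofReal (Real.exp_le_one_iff.mpr ?_)
      have := mul_nonneg (Nat.cast_nonneg (α := ℝ) n) (Z t ω).coe_nonneg
      linarith
    · by_cases h0 : Z t ω = 0
      · simp [h0]
      · have hpos : 0 < (Z t ω : ℝ) := by exact_mod_cast pos_iff_ne_zero.mpr h0
        rw [indicator_of_notMem (by simpa using h0), ← ENNReal.ofReal_zero]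
        refine (ENNReal.continuous_ofReal.tendsto 0).comp (Real.tendsto_exp_neg_atTop_nhds_zero.comp
          (tendsto_natCast_atTop_atTop.atTop_mul_const hpos))
  rw [lintegral_indicator_one hmeas] at h1
  refine tendsto_nhds_unique h1 ?_
  have h2 : Tendsto (fun n : ℕ => ENNReal.ofReal
      (Real.exp (-((x : ℝ) * b.phiInv (t + b.phi (n : ℝ)))))) atTop
      (𝓝 (ENNReal.ofReal (Real.exp (-((x : ℝ) * b.phiInv t))))) := by
    have h3 := (BranchingMechanism.tendsto_phiInv_add_phi hα hG (t := t)
      (by exact_mod_cast ht)).comp tendsto_natCast_atTop_atTop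
    exact (ENNReal.continuous_ofReal.tendsto _).comp
      ((Real.continuous_exp.tendsto _).comp (h3.const_mul (x : ℝ)).neg)
  refine h2.congr' ?_
  filter_upwards [eventually_gt_atTop 0] with n hn
  rw [h.lintegral_exp hα hG (by exact_mod_cast hn)]

lemma lintegral_exp_ne_zero (h : IsCBProcess b Pr Z) (hα : 0 ≤ b.α) (hG : b.GreyCondition)
    {lam : ℝ} (hlam : 0 < lam) (x : ℝ≥0) {t : ℝ≥0} (ht : 0 < t) :
    ∫⁻ ω in {ω | Z t ω ≠ 0}, ENNReal.ofReal (Real.exp (-(lam * (Z t ω : ℝ)))) ∂Pr x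
      + ENNReal.ofReal (Real.exp (-((x : ℝ) * b.phiInv t)))
      = ENNReal.ofReal (Real.exp (-((x : ℝ) * b.phiInv (t + b.phi lam)))) := by
  have hZ := h.measurable_apply t
  have hmeas : MeasurableSet {ω | Z t ω = 0} := (measurableSet_singleton 0).preimage hZ
  rw [← h.lintegral_exp hα hG hlam, ← lintegral_add_compl (μ := Pr x)
    (fun ω => ENNReal.ofReal (Real.exp (-(lam * (Z t ω : ℝ))))) hmeas, add_comm]
  congr 1
  rw [setLIntegral_congr_fun (g := fun _ => 1) hmeas fun ω hω => by
    have hω : Z t ω = 0 := hω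
    simp [hω]]
  simp [h.measure_eq_zero hα hG x ht]

lemma laplacePos_lawOnPos_kernel (h : IsCBProcess b Pr Z) (hα : 0 ≤ b.α) (hG : b.GreyCondition)
    {lam : ℝ} (hlam : 0 < lam) (x : ℝ≥0) {t : ℝ≥0} (ht : 0 < t) :
    laplacePos (lawOnPos (Pr x) Z t) lam
      = ENNReal.ofReal (Real.exp (-((x : ℝ) * b.phiInv (t + b.phi lam)))
        - Real.exp (-((x : ℝ) * b.phiInv t))) := by
  rw [laplacePos_lawOnPos _ (h.measurable_apply t), ENNReal.ofReal_sub _ (Real.exp_pos _).le,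
    ← h.lintegral_exp_ne_zero hα hG hlam x ht, ENNReal.add_sub_cancel_right ENNReal.ofReal_ne_top]

lemma lawOnPos_kernel_univ (h : IsCBProcess b Pr Z) (hα : 0 ≤ b.α) (hG : b.GreyCondition)
    (x : ℝ≥0) {t : ℝ≥0} (ht : 0 < t) :
    lawOnPos (Pr x) Z t univ = ENNReal.ofReal (1 - Real.exp (-((x : ℝ) * b.phiInv t))) := by
  have := h.isMarkovKernel
  have hZ := h.measurable_apply t
  rw [lawOnPos_univ _ hZ, ENNReal.ofReal_sub _ (Real.exp_pos _).le, ENNReal.ofReal_one,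
    ← h.measure_eq_zero hα hG x ht]
  exact prob_compl_eq_one_sub ((measurableSet_singleton 0).preimage hZ)

lemma lintegral_initialLaw (ν : Measure PosHalfLine) {f : Ω → ℝ≥0∞} (hf : Measurable f) :
    ∫⁻ ω, f ω ∂(initialLaw Pr ν)
      = ∫⁻ x : PosHalfLine, ∫⁻ ω, f ω ∂(Pr (x : ℝ).toNNReal) ∂ν := by
  rw [initialLaw, Measure.lintegral_bind Pr.aemeasurable hf.aemeasurable,
    lintegral_map hf.lintegral_kernel (by fun_prop)]

lemma coe_toNNReal_val (x : PosHalfLine) : (((x : ℝ).toNNReal : ℝ≥0) : ℝ) = x :=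
  Real.coe_toNNReal _ (mem_Ioi.mp x.2).le

/-- Integrating `exp(-x q)` over `ν(dx)` gives the transform of `ν` at `q`. The identity is a sum
because subtraction in `[0, ∞]` would lose information when a term is infinite. -/
lemma laplacePos_lawOnPos_initialLaw (h : IsCBProcess b Pr Z) (hα : 0 ≤ b.α)
    (hG : b.GreyCondition) (ν : Measure PosHalfLine) {lam : ℝ} (hlam : 0 < lam) {t : ℝ≥0}
    (ht : 0 < t) :
    laplacePos (lawOnPos (initialLaw Pr ν) Z t) lam + laplacePos ν (b.phiInv t)
      = laplacePos ν (b.phiInv (t + b.phi lam)) := by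
  have hZ := h.measurable_apply t
  have hmeas : MeasurableSet {ω | Z t ω ≠ 0} := (measurableSet_singleton 0).compl.preimage hZ
  rw [laplacePos_lawOnPos _ hZ, ← lintegral_indicator hmeas,
    lintegral_initialLaw ν (Measurable.indicator (by fun_prop) hmeas)]
  simp_rw [lintegral_indicator hmeas]
  simp only [laplacePos]
  rw [← lintegral_add_right _ (by fun_prop)]
  refine lintegral_congr fun x => ?_
  have := h.lintegral_exp_ne_zero hα hG hlam (x : ℝ).toNNReal ht
  rw [coe_toNNReal_val] at this
  rw [mul_comm (b.phiInv t), mul_comm (b.phiInv _)]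
  exact this

end IsCBProcess

end Laws

/-! ### The subcritical case -/

lemma measure_singleton_le_laplace (m : Measure ℝ) (lam : ℝ) : m {0} ≤ laplace m lam := by
  calc m {0} = ∫⁻ y in {0}, ENNReal.ofReal (Real.exp (-(lam * y))) ∂m := by simp
    _ ≤ laplace m lam := setLIntegral_le_lintegral _ _

/-- A pointwise limit of Laplace transforms that vanishes at infinity is the Laplace transform of a
measure on `(0, ∞)`. -/
theorem exists_measure_of_tendsto_laplacePos {ι : Type*} {l : Filter ι} [l.NeBot]
    {νs : ι → Measure PosHalfLine} {L : ℝ → ℝ≥0∞} (hL : ∀ lam, 0 < lam → L lam ≠ ∞)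
    (h : ∀ lam, 0 < lam → Tendsto (fun i => laplacePos (νs i) lam) l (𝓝 (L lam)))
    (hL0 : Tendsto L atTop (𝓝 0)) :
    ∃ ν : Measure PosHalfLine, ∀ lam, 0 < lam → laplacePos ν lam = L lam := by
  obtain ⟨m, hm, hmL⟩ := exists_measure_of_tendsto_laplace (fun i => map_val_Iio (νs i)) hL
    fun lam hlam => by simpa only [laplace_map_val] using h lam hlam
  have h0 : m {0} = 0 := by
    refine le_antisymm (ge_of_tendsto hL0 ?_) bot_le
    filter_upwards [eventually_gt_atTop 0] with lam hlam
    exact hmL lam hlam ▸ measure_singleton_le_laplace m lam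
  refine ⟨m.comap Subtype.val, fun lam hlam => ?_⟩
  rw [← laplace_map_val, ← hmL lam hlam,
    (MeasurableEmbedding.subtype_coe (measurableSet_Ioi (a := (0 : ℝ)))).map_comap,
    Subtype.range_coe, Measure.restrict_eq_self_of_ae_mem]
  rw [ae_iff]
  refine measure_mono_null (t := Iio 0 ∪ {0}) (fun y hy => ?_) (measure_union_null hm h0)
  simpa [le_iff_lt_or_eq] using hy

lemma tendsto_laplacePos_univ (ν : Measure PosHalfLine) :
    Tendsto (fun n : ℕ => laplacePos ν (1 / ((n : ℝ) + 1))) atTop (𝓝 (ν univ)) := by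
  rw [← laplacePos_zero]
  refine lintegral_tendsto_of_tendsto_of_monotone (fun n => by fun_prop) (.of_forall fun y => ?_)
    (.of_forall fun y => ?_)
  · intro n k hnk
    refine ENNReal.ofReal_le_ofReal (Real.exp_le_exp.mpr (neg_le_neg ?_))
    exact mul_le_mul_of_nonneg_right (Nat.one_div_le_one_div hnk) (mem_Ioi.mp y.2).le
  · have h1 : Tendsto (fun n : ℕ => -(1 / ((n : ℝ) + 1) * (y : ℝ))) atTop (𝓝 (-(0 * (y : ℝ)))) :=
      (tendsto_one_div_add_atTop_nhds_zero_nat.mul_const (y : ℝ)).neg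
    exact (ENNReal.continuous_ofReal.tendsto _).comp ((Real.continuous_exp.tendsto _).comp h1)

namespace IsCBProcess

variable {Ω : Type*} [MeasurableSpace Ω] {b : BranchingMechanism} {Pr : Kernel ℝ≥0 Ω}
  {Z : ℝ≥0 → Ω → ℝ≥0}

open BranchingMechanism

lemma laplacePos_lawOnPos_cond (h : IsCBProcess b Pr Z) (hα : 0 ≤ b.α) (hG : b.GreyCondition)
    {lam : ℝ} (hlam : 0 < lam) {x t : ℝ≥0} (hx : 0 < x) (ht : 0 < t) :
    laplacePos (lawOnPos ((Pr x)[|survival Z t]) Z t) lam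
      = ENNReal.ofReal ((Real.exp (-((x : ℝ) * b.phiInv (t + b.phi lam)))
        - Real.exp (-((x : ℝ) * b.phiInv t))) / (1 - Real.exp (-((x : ℝ) * b.phiInv t)))) := by
  have hq := phiInv_pos hα hG (t := t) (by exact_mod_cast ht)
  have hxq : 0 < (x : ℝ) * b.phiInv t := mul_pos (by exact_mod_cast hx) hq
  have hpos : 0 < 1 - Real.exp (-((x : ℝ) * b.phiInv t)) := by
    rw [sub_pos, ← Real.exp_zero]
    exact Real.exp_lt_exp.mpr (by linarith)
  rw [h.lawOnPos_cond, laplacePos_smul, h.lawOnPos_kernel_univ hα hG x ht,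
    h.laplacePos_lawOnPos_kernel hα hG hlam x ht, ENNReal.ofReal_div_of_pos hpos, mul_comm,
    ENNReal.div_eq_inv_mul, mul_comm]

lemma tendsto_laplacePos_lawOnPos_cond (h : IsCBProcess b Pr Z) (hα : 0 < b.α)
    (hG : b.GreyCondition) {lam : ℝ} (hlam : 0 < lam) {x : ℝ≥0} (hx : 0 < x) :
    Tendsto (fun t => laplacePos (lawOnPos ((Pr x)[|survival Z t]) Z t) lam) atTop
      (𝓝 (ENNReal.ofReal (1 - Real.exp (-(b.α * b.phi lam))))) := by
  have hx' : (0 : ℝ) < x := by exact_mod_cast hx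
  have hs := phi_pos hα.le hG hlam
  have h1 := tendsto_exp_sub_exp_div hα.le hG hs hx'
    (tendsto_phiInv_sub_div_subcritical hα hG hs)
  have h2 := h1.div (tendsto_one_sub_exp_phiInv_div hα hG hx') (by positivity)
  have h3 : (1 - Real.exp (-(b.α * b.phi lam))) / b.α / (1 / b.α)
      = 1 - Real.exp (-(b.α * b.phi lam)) := by field_simp
  rw [h3] at h2
  refine ((ENNReal.continuous_ofReal.tendsto _).comp
    (h2.comp (NNReal.tendsto_coe_atTop.mpr tendsto_id))).congr' ?_
  filter_upwards [eventually_gt_atTop 0] with t ht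
  rw [h.laplacePos_lawOnPos_cond hα.le hG hlam hx ht]
  have hp := psi_pos hα.le hG (phiInv_pos hα.le hG (t := t) (by exact_mod_cast ht))
  simp only [Function.comp_apply, Pi.div_apply, id]
  rw [div_div_div_cancel_right₀ (by positivity)]

lemma isProbabilityMeasure_lawOnPos_cond (h : IsCBProcess b Pr Z) (hα : 0 ≤ b.α)
    (hG : b.GreyCondition) {x t : ℝ≥0} (hx : 0 < x) (ht : 0 < t) :
    lawOnPos ((Pr x)[|survival Z t]) Z t univ = 1 := by
  have hq := phiInv_pos hα hG (t := t) (by exact_mod_cast ht)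
  have hxq : 0 < (x : ℝ) * b.phiInv t := mul_pos (by exact_mod_cast hx) hq
  have hpos : 0 < 1 - Real.exp (-((x : ℝ) * b.phiInv t)) := by
    rw [sub_pos, ← Real.exp_zero]
    exact Real.exp_lt_exp.mpr (by linarith)
  rw [h.lawOnPos_cond, Measure.smul_apply, smul_eq_mul, h.lawOnPos_kernel_univ hα hG x ht]
  exact ENNReal.inv_mul_cancel (ENNReal.ofReal_pos.mpr hpos).ne' ENNReal.ofReal_ne_top

/-- The limit of the conditioned transforms started from `1` is a transform. It vanishes at `λ = ∞`
as `φ(∞) = 0`, so there is no atom at `0`; the mass is `1` as `φ(0+) = ∞`. -/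
lemma exists_yaglom_laplace (h : IsCBProcess b Pr Z) (hα : 0 < b.α) (hG : b.GreyCondition) :
    ∃ ν : Measure PosHalfLine, IsProbabilityMeasure ν ∧ ∀ lam, 0 < lam →
      laplacePos ν lam = ENNReal.ofReal (1 - Real.exp (-(b.α * b.phi lam))) := by
  obtain ⟨ν, hν⟩ := exists_measure_of_tendsto_laplacePos
    (L := fun lam => ENNReal.ofReal (1 - Real.exp (-(b.α * b.phi lam))))
    (fun _ _ => ENNReal.ofReal_ne_top)
    (fun lam hlam => h.tendsto_laplacePos_lawOnPos_cond hα hG hlam one_pos) (by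
      have h1 := ((tendsto_phi_atTop hα.le hG).const_mul b.α).neg
      have h2 := ((Real.continuous_exp.tendsto _).comp h1).const_sub 1
      have h3 := (ENNReal.continuous_ofReal.tendsto _).comp h2
      simpa [Function.comp_def] using h3)
  refine ⟨ν, ⟨?_⟩, hν⟩
  have hseq : Tendsto (fun n : ℕ => 1 / ((n : ℝ) + 1)) atTop (𝓝[>] 0) :=
    tendsto_nhdsWithin_iff.mpr ⟨tendsto_one_div_add_atTop_nhds_zero_nat,
      .of_forall fun n => mem_Ioi.mpr (by positivity)⟩
  have h1 : Tendsto (fun n : ℕ => -(b.α * b.phi (1 / ((n : ℝ) + 1)))) atTop atBot :=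
    tendsto_neg_atTop_atBot.comp
      (((tendsto_phi_zero hα.le hG).comp hseq).const_mul_atTop hα)
  have h2 := (ENNReal.continuous_ofReal.tendsto _).comp
    ((Real.tendsto_exp_atBot.comp h1).const_sub 1)
  rw [sub_zero, ENNReal.ofReal_one] at h2
  refine tendsto_nhds_unique (tendsto_laplacePos_univ ν) (h2.congr fun n => ?_)
  rw [hν _ (by positivity)]
  rfl

/-- With `s = φ(λ)`, this is `exp(-α t) - exp(-α (t + s)) = exp(-α t) (1 - exp(-α s))`. -/
lemma lawOnPos_initialLaw_yaglom (h : IsCBProcess b Pr Z) (hα : 0 < b.α) (hG : b.GreyCondition)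
    {ν : Measure PosHalfLine} (hν : ∀ lam, 0 < lam →
      laplacePos ν lam = ENNReal.ofReal (1 - Real.exp (-(b.α * b.phi lam)))) {t : ℝ≥0}
    (ht : 0 < t) :
    lawOnPos (initialLaw Pr ν) Z t = ENNReal.ofReal (Real.exp (-(b.α * t))) • ν := by
  have ht' : (0 : ℝ) < t := by exact_mod_cast ht
  have hlap (lam : ℝ) (hlam : 0 < lam) : laplacePos (lawOnPos (initialLaw Pr ν) Z t) lam
      = laplacePos (ENNReal.ofReal (Real.exp (-(b.α * t))) • ν) lam := by
    have hs := phi_pos hα.le hG hlam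
    have key := h.laplacePos_lawOnPos_initialLaw hα.le hG ν hlam ht
    rw [hν _ (phiInv_pos hα.le hG ht'), hν _ (phiInv_pos hα.le hG (add_pos ht' hs)),
      phi_phiInv hα.le hG ht', phi_phiInv hα.le hG (add_pos ht' hs)] at key
    rw [← ENNReal.add_left_inj (ENNReal.ofReal_ne_top (r := 1 - Real.exp (-(b.α * t)))), key,
      laplacePos_smul, hν _ hlam, ← ENNReal.ofReal_mul (Real.exp_pos _).le, ← ENNReal.ofReal_add]
    · rw [mul_sub, ← Real.exp_add]
      congr 1
      rw [mul_add, neg_add]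
      ring
    · refine mul_nonneg (Real.exp_pos _).le (sub_nonneg.mpr (Real.exp_le_one_iff.mpr ?_))
      have := mul_pos hα hs
      linarith
    · refine sub_nonneg.mpr (Real.exp_le_one_iff.mpr ?_)
      have := mul_pos hα ht'
      linarith
  refine ext_of_laplacePos (fun lam hlam => ?_) hlap
  rw [hlap lam hlam, laplacePos_smul, hν lam hlam]
  exact ENNReal.mul_ne_top ENNReal.ofReal_ne_top ENNReal.ofReal_ne_top

lemma isYaglomDistribution (h : IsCBProcess b Pr Z) (hα : 0 < b.α) (hG : b.GreyCondition)
    {ν : Measure PosHalfLine} [IsProbabilityMeasure ν] (hν : ∀ lam, 0 < lam →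
      laplacePos ν lam = ENNReal.ofReal (1 - Real.exp (-(b.α * b.phi lam)))) :
    IsYaglomDistribution b Pr Z ν where
  isProbabilityMeasure := inferInstance
  laplace lam hlam := by
    rw [integral_eq_lintegral_of_nonneg_ae (.of_forall fun _ => (Real.exp_pos _).le)
      (by fun_prop)]
    refine (congrArg ENNReal.toReal (hν lam hlam)).trans (ENNReal.toReal_ofReal ?_)
    refine sub_nonneg.mpr (Real.exp_le_one_iff.mpr ?_)
    have := mul_pos hα (phi_pos hα.le hG hlam)
    linarith
  quasiStationary t ht A _ := by
    have huniv : (ENNReal.ofReal (Real.exp (-(b.α * t))) • ν) univ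
        = ENNReal.ofReal (Real.exp (-(b.α * t))) := by simp
    rw [h.lawOnPos_cond, h.lawOnPos_initialLaw_yaglom hα hG hν ht, huniv, smul_smul, ENNReal.inv_mul_cancel
        (ENNReal.ofReal_pos.mpr (Real.exp_pos _)).ne' ENNReal.ofReal_ne_top, one_smul]
  conditionalLimit x hx := by
    refine fun f => tendsto_lintegral_of_tendsto_laplacePos (measure_ne_top ν univ) (fun n => ?_) f
    -- The value at `n = 0` is the total mass; its convergence separates weak from vague
    -- convergence.
    rcases n.eq_zero_or_pos with rfl | hn
    · simp only [Nat.cast_zero, laplacePos_zero, measure_univ]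
      refine tendsto_const_nhds.congr' ?_
      filter_upwards [eventually_gt_atTop 0] with t ht
      exact (h.isProbabilityMeasure_lawOnPos_cond hα.le hG hx ht).symm
    · have hn' : (0 : ℝ) < n := by exact_mod_cast hn
      rw [hν _ hn']
      exact h.tendsto_laplacePos_lawOnPos_cond hα hG hn' hx

lemma laplacePos_normalizedTransition (h : IsCBProcess b Pr Z) (hα : 0 ≤ b.α)
    (hG : b.GreyCondition) {lam : ℝ} (hlam : 0 < lam) {x t : ℝ≥0} (hx : 0 < x) (ht : 0 < t) :
    laplacePos (normalizedTransition b Pr Z x t) lam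
      = ENNReal.ofReal ((Real.exp (-((x : ℝ) * b.phiInv (t + b.phi lam)))
        - Real.exp (-((x : ℝ) * b.phiInv t))) / ((x : ℝ) * b.psi (b.phiInv t))) := by
  have hp := psi_pos hα hG (phiInv_pos hα hG (t := t) (by exact_mod_cast ht))
  have hx' : (0 : ℝ) < x := by exact_mod_cast hx
  rw [normalizedTransition, laplacePos_smul, h.laplacePos_lawOnPos_kernel hα hG hlam x ht,
    ← ENNReal.ofReal_mul (by positivity), one_div_mul_eq_div]

lemma tendsto_laplacePos_normalizedTransition (h : IsCBProcess b Pr Z) (hα : 0 ≤ b.α)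
    (hG : b.GreyCondition) {lam c : ℝ} (hlam : 0 < lam) {x : ℝ≥0} (hx : 0 < x)
    (hc : Tendsto (fun t => (b.phiInv t - b.phiInv (t + b.phi lam)) / b.psi (b.phiInv t)) atTop
      (𝓝 c)) :
    Tendsto (fun t => laplacePos (normalizedTransition b Pr Z x t) lam) atTop
      (𝓝 (ENNReal.ofReal c)) := by
  have h1 := tendsto_exp_sub_exp_div hα hG (phi_pos hα hG hlam)
    (x := x) (by exact_mod_cast hx) hc
  refine ((ENNReal.continuous_ofReal.tendsto _).comp
    (h1.comp (NNReal.tendsto_coe_atTop.mpr tendsto_id))).congr' ?_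
  filter_upwards [eventually_gt_atTop 0] with t ht
  rw [h.laplacePos_normalizedTransition hα hG hlam hx ht]
  rfl

lemma tendstoWeakly_normalizedTransition (h : IsCBProcess b Pr Z) (hα : 0 < b.α)
    (hG : b.GreyCondition) {ν : Measure PosHalfLine} [IsProbabilityMeasure ν]
    (hν : ∀ lam, 0 < lam →
      laplacePos ν lam = ENNReal.ofReal (1 - Real.exp (-(b.α * b.phi lam)))) {x : ℝ≥0}
    (hx : 0 < x) :
    TendstoWeakly (normalizedTransition b Pr Z x) (ENNReal.ofReal (1 / b.α) • ν) := by
  have hx' : (0 : ℝ) < x := by exact_mod_cast hx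
  refine fun f => tendsto_lintegral_of_tendsto_laplacePos ?_ (fun n => ?_) f
  · simp
  rcases n.eq_zero_or_pos with rfl | hn
  · have h1 := tendsto_one_sub_exp_phiInv_div hα hG hx'
    simp only [Nat.cast_zero, laplacePos_zero, Measure.smul_apply, measure_univ, smul_eq_mul,
      mul_one]
    refine ((ENNReal.continuous_ofReal.tendsto _).comp
      (h1.comp (NNReal.tendsto_coe_atTop.mpr tendsto_id))).congr' ?_
    filter_upwards [eventually_gt_atTop 0] with t ht
    have hp := psi_pos hα.le hG (phiInv_pos hα.le hG (t := t) (by exact_mod_cast ht))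
    rw [normalizedTransition, Measure.smul_apply, smul_eq_mul,
      h.lawOnPos_kernel_univ hα.le hG x ht, ← ENNReal.ofReal_mul (by positivity),
      one_div_mul_eq_div]
    rfl
  · have hn' : (0 : ℝ) < n := by exact_mod_cast hn
    rw [laplacePos_smul, hν _ hn', ← ENNReal.ofReal_mul (by positivity), one_div_mul_eq_div]
    exact h.tendsto_laplacePos_normalizedTransition hα.le hG hn' hx
      (tendsto_phiInv_sub_div_subcritical hα hG (phi_pos hα.le hG hn'))

/-! ### The critical case, for a measure with Laplace transform `φ` -/

lemma isStationary (h : IsCBProcess b Pr Z) (hα : 0 ≤ b.α) (hG : b.GreyCondition)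
    {μ : Measure PosHalfLine} [IsLocallyFiniteMeasure μ]
    (hμ : ∀ lam, 0 < lam → laplacePos μ lam = ENNReal.ofReal (b.phi lam)) :
    IsStationary Pr Z μ := by
  refine ⟨inferInstance, fun t ht A _ => ?_⟩
  have ht' : (0 : ℝ) < t := by exact_mod_cast ht
  have hlap (lam : ℝ) (hlam : 0 < lam) :
      laplacePos (lawOnPos (initialLaw Pr μ) Z t) lam = laplacePos μ lam := by
    have hs := phi_pos hα hG hlam
    have key := h.laplacePos_lawOnPos_initialLaw hα hG μ hlam ht
    rw [hμ _ (phiInv_pos hα hG ht'), hμ _ (phiInv_pos hα hG (add_pos ht' hs)),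
      phi_phiInv hα hG ht', phi_phiInv hα hG (add_pos ht' hs)] at key
    rw [← ENNReal.add_left_inj (ENNReal.ofReal_ne_top (r := (t : ℝ))), key, hμ _ hlam,
      ← ENNReal.ofReal_add hs.le ht'.le, add_comm]
  rw [ext_of_laplacePos (fun lam hlam => ?_) hlap]
  rw [hlap lam hlam, hμ lam hlam]
  exact ENNReal.ofReal_ne_top

lemma tendstoVaguely_normalizedTransition (h : IsCBProcess b Pr Z) (hα : b.α = 0)
    (hG : b.GreyCondition) {μ : Measure PosHalfLine}
    (hμ : ∀ lam, 0 < lam → laplacePos μ lam = ENNReal.ofReal (b.phi lam)) {x : ℝ≥0} (hx : 0 < x) :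
    TendstoVaguely (normalizedTransition b Pr Z x) μ := by
  refine tendsto_lintegral_compactlySupported_of_tendsto_laplacePos (fun lam hlam => ?_)
    fun lam hlam => ?_
  · rw [hμ lam hlam]; exact ENNReal.ofReal_ne_top
  · rw [hμ lam hlam]
    exact h.tendsto_laplacePos_normalizedTransition hα.ge hG hlam hx
      (tendsto_phiInv_sub_div_critical hα hG (phi_pos hα.ge hG hlam))

end IsCBProcess

/-! ### Exponential integrals and convolutions -/

lemma lintegral_exp_Ioi {lam : ℝ} (hlam : 0 < lam) (c : ℝ) :
    ∫⁻ x in Ioi c, ENNReal.ofReal (Real.exp (-(lam * x)))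
      = ENNReal.ofReal (Real.exp (-(lam * c)) / lam) := by
  have h1 := integrableOn_exp_mul_Ioi (neg_neg_of_pos hlam) c
  have h2 := integral_exp_mul_Ioi (neg_neg_of_pos hlam) c
  simp only [neg_mul] at h1 h2
  rw [← ofReal_integral_eq_lintegral_ofReal h1 (.of_forall fun _ => (Real.exp_pos _).le), h2,
    neg_div_neg_eq]

lemma laplace_volume_Ioi {lam : ℝ} (hlam : 0 < lam) :
    laplace (volume.restrict (Ioi 0)) lam = ENNReal.ofReal (1 / lam) := by
  rw [laplace, lintegral_exp_Ioi hlam]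
  simp

lemma ofReal_exp_add (lam x y : ℝ) : ENNReal.ofReal (Real.exp (-(lam * (x + y))))
    = ENNReal.ofReal (Real.exp (-(lam * x))) * ENNReal.ofReal (Real.exp (-(lam * y))) := by
  rw [← ENNReal.ofReal_mul (Real.exp_pos _).le, ← Real.exp_add]
  congr 2; ring

lemma laplace_conv (m m' : Measure ℝ) [SFinite m'] (lam : ℝ) :
    laplace (m.conv m') lam = laplace m lam * laplace m' lam := by
  rw [laplace, Measure.lintegral_conv (by fun_prop)]
  simp_rw [ofReal_exp_add]
  simp_rw [lintegral_const_mul' _ _ ENNReal.ofReal_ne_top]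
  rw [lintegral_mul_const _ (by fun_prop)]
  rfl

lemma conv_Iio {m m' : Measure ℝ} [SFinite m'] (hm : m (Iio 0) = 0) (hm' : m' (Iio 0) = 0) :
    m.conv m' (Iio 0) = 0 := by
  rw [← lintegral_indicator_one measurableSet_Iio,
    Measure.lintegral_conv (measurable_one.indicator measurableSet_Iio)]
  refine (lintegral_eq_zero_iff' ?_).mpr ?_
  · exact Measurable.aemeasurable (Measurable.lintegral_prod_right'
      (f := fun p : ℝ × ℝ => (Iio (0 : ℝ)).indicator 1 (p.1 + p.2))
      ((measurable_one.indicator measurableSet_Iio).comp (by fun_prop)))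
  filter_upwards [ae_nonneg_of_Iio hm] with x hx
  refine (lintegral_congr_ae ?_).trans lintegral_zero
  filter_upwards [ae_nonneg_of_Iio hm'] with y hy
  exact indicator_of_notMem (by simpa using add_nonneg hx hy) _

lemma laplace_dirac (a lam : ℝ) :
    laplace (Measure.dirac a) lam = ENNReal.ofReal (Real.exp (-(lam * a))) := by
  rw [laplace, lintegral_dirac' _ (by fun_prop)]

lemma laplace_smul (c : ℝ≥0∞) (m : Measure ℝ) (lam : ℝ) :
    laplace (c • m) lam = c * laplace m lam := by
  simp [laplace, lintegral_smul_measure]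

lemma laplace_add (m m' : Measure ℝ) (lam : ℝ) :
    laplace (m + m') lam = laplace m lam + laplace m' lam := by
  simp [laplace, lintegral_add_measure]

lemma sfinite_of_laplace_ne_top {m : Measure ℝ} {lam : ℝ} (h : laplace m lam ≠ ∞) : SFinite m := by
  have hmeas : Measurable fun y : ℝ => ENNReal.ofReal (Real.exp (-(lam * y))) := by fun_prop
  rw [← withDensity_inv_same (μ := m) hmeas
    (.of_forall fun y => (ENNReal.ofReal_pos.mpr (Real.exp_pos _)).ne')
    (.of_forall fun y => ENNReal.ofReal_ne_top)]
  have := isFiniteMeasure_withDensity (μ := m) h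
  infer_instance

/-! ### Potential measures of compound Poisson subordinators -/

/-- The convolution powers of a measure. -/
def convPow (p : Measure ℝ) : ℕ → Measure ℝ
  | 0 => Measure.dirac 0
  | n + 1 => (convPow p n).conv p

lemma laplace_convPow (p : Measure ℝ) [SFinite p] (lam : ℝ) (n : ℕ) :
    laplace (convPow p n) lam = laplace p lam ^ n := by
  induction n with
  | zero => simp [convPow, laplace_dirac]
  | succ n ih => rw [convPow, laplace_conv, ih, pow_succ]

lemma convPow_Iio {p : Measure ℝ} [SFinite p] (hp : p (Iio 0) = 0) (n : ℕ) :
    convPow p n (Iio 0) = 0 := by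
  induction n with
  | zero => simp [convPow]
  | succ n ih => exact conv_Iio ih hp

lemma lintegral_one_sub_exp_add_laplace {ρ : Measure ℝ} (hρ : ρ (Iio 0) = 0) {lam : ℝ}
    (hlam : 0 ≤ lam) :
    ∫⁻ y, ENNReal.ofReal (1 - Real.exp (-(lam * y))) ∂ρ + laplace ρ lam = ρ univ := by
  rw [laplace, ← lintegral_add_right _ (by fun_prop), ← lintegral_one]
  refine lintegral_congr_ae ?_
  filter_upwards [ae_nonneg_of_Iio hρ] with y hy
  have : Real.exp (-(lam * y)) ≤ 1 :=
    Real.exp_le_one_iff.mpr (neg_nonpos.mpr (mul_nonneg hlam hy))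
  rw [← ENNReal.ofReal_add (by linarith) (Real.exp_pos _).le]
  simp

/-- The reciprocal of the Laplace exponent of a compound Poisson subordinator is the Laplace
transform of its potential measure. -/
lemma exists_laplace_eq_inv (ρ : Measure ℝ) [IsFiniteMeasure ρ] (hρ : ρ (Iio 0) = 0) :
    ∃ U : Measure ℝ, U (Iio 0) = 0 ∧ ∀ lam, 0 < lam →
      laplace U lam = (∫⁻ y, ENNReal.ofReal (1 - Real.exp (-(lam * y))) ∂ρ)⁻¹ := by
  rcases eq_or_ne ρ 0 with rfl | hne
  -- For `ρ = 0` the exponent is `0`, with inverse `∞` in `[0, ∞]`.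
  · refine ⟨∞ • Measure.dirac 0, by simp, fun lam _ => ?_⟩
    rw [laplace_smul, laplace_dirac]
    simp
  have hc0 : ρ univ ≠ 0 := by simpa using hne
  have hc : ρ univ ≠ ∞ := measure_ne_top ρ univ
  have : IsFiniteMeasure ((ρ univ)⁻¹ • ρ) := ρ.smul_finite (ENNReal.inv_ne_top.mpr hc0)
  -- With `c` the mass of `ρ`, this is the expected occupation measure: holding times of mean `1/c`
  -- between jumps of law `ρ/c`. Its transform is a geometric series.
  refine ⟨(ρ univ)⁻¹ • Measure.sum (convPow ((ρ univ)⁻¹ • ρ)), ?_, fun lam hlam => ?_⟩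
  · rw [Measure.smul_apply, Measure.sum_apply _ measurableSet_Iio]
    simp [convPow_Iio (p := (ρ univ)⁻¹ • ρ) (by simp [hρ])]
  · have h1 : laplace (Measure.sum (convPow ((ρ univ)⁻¹ • ρ))) lam
        = (1 - (ρ univ)⁻¹ * laplace ρ lam)⁻¹ := by
      rw [laplace, lintegral_sum_measure, ← ENNReal.tsum_geometric]
      congr 1
      ext n
      exact (laplace_convPow _ lam n).trans (by rw [laplace_smul])
    have h2 := lintegral_one_sub_exp_add_laplace hρ hlam.le
    have h3 : laplace ρ lam ≠ ∞ := ne_top_of_le_ne_top hc (h2 ▸ le_add_self)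
    rw [laplace_smul, h1, ← ENNReal.mul_inv (Or.inl hc0) (Or.inl hc),
      ENNReal.mul_sub fun _ _ => hc, mul_one, ← mul_assoc, ENNReal.mul_inv_cancel hc0 hc, one_mul,
      ← h2, ENNReal.add_sub_cancel_right h3]

/-! ### The tail of the Lévy measure -/

namespace BranchingMechanism

variable (b : BranchingMechanism)

/-- The tail `r ↦ π(r, ∞)`. -/
def tail (r : ℝ) : ℝ≥0∞ := b.π {s : PosHalfLine | r < s}

lemma antitone_tail : Antitone b.tail :=
  fun _ _ h => measure_mono fun _ hs => lt_of_le_of_lt h hs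

lemma measurable_tail : Measurable b.tail := b.antitone_tail.measurable

/-- The measure `π(r, ∞) dr` on `(0, ∞)`. -/
def tailMeasure : Measure ℝ := (volume.restrict (Ioi 0)).withDensity b.tail

lemma tailMeasure_Iic : b.tailMeasure (Iic 0) = 0 := by
  refine withDensity_absolutelyContinuous _ _ ?_
  rw [Measure.restrict_apply measurableSet_Iic]
  simp [Iic_inter_Ioi]

lemma tailMeasure_Iio : b.tailMeasure (Iio 0) = 0 :=
  measure_mono_null Iio_subset_Iic_self b.tailMeasure_Iic

lemma integral_one_sub_exp {lam : ℝ} (hlam : 0 < lam) (s : ℝ) :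
    ∫ t in (0 : ℝ)..s, (1 - Real.exp (-(lam * t)))
      = (Real.exp (-(lam * s)) - 1 + lam * s) / lam := by
  have hd (x : ℝ) : HasDerivAt (fun t => (Real.exp (-(lam * t)) - 1 + lam * t) / lam)
      (1 - Real.exp (-(lam * x))) x := by
    have h1 : HasDerivAt (fun t => lam * t) lam x := by
      simpa using (hasDerivAt_id x).const_mul lam
    refine (((h1.fun_neg.exp.sub_const 1).add h1).div_const lam).congr_deriv ?_
    field_simp
    ring
  rw [intervalIntegral.integral_eq_sub_of_hasDerivAt (fun x _ => hd x)
    (Continuous.intervalIntegrable (by fun_prop) _ _)]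
  simp

lemma integral_exp_neg_mul {lam : ℝ} (hlam : 0 < lam) (s : ℝ) :
    ∫ t in (0 : ℝ)..s, Real.exp (-(lam * t)) = (1 - Real.exp (-(lam * s))) / lam := by
  have hd (x : ℝ) : HasDerivAt (fun t => (1 - Real.exp (-(lam * t))) / lam)
      (Real.exp (-(lam * x))) x := by
    have h1 : HasDerivAt (fun t => lam * t) lam x := by
      simpa using (hasDerivAt_id x).const_mul lam
    refine ((h1.fun_neg.exp.const_sub 1).div_const lam).congr_deriv ?_
    field_simp
  rw [intervalIntegral.integral_eq_sub_of_hasDerivAt (fun x _ => hd x)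
    (Continuous.intervalIntegrable (by fun_prop) _ _)]
  simp

/-- Layer cake formula: the kernel of `ψ`, divided by `lam`, is the primitive of `1 - exp(-lam t)`.
-/
lemma lintegral_tailMeasure {lam : ℝ} (hlam : 0 < lam) :
    ∫⁻ r, ENNReal.ofReal (1 - Real.exp (-(lam * r))) ∂b.tailMeasure
      = ENNReal.ofReal ((∫ r : PosHalfLine, (Real.exp (-(lam * (r : ℝ))) - 1 + lam * (r : ℝ)) ∂b.π)
          / lam) := by
  have hnn : ∀ᵐ t ∂volume.restrict (Ioi (0 : ℝ)), 0 ≤ 1 - Real.exp (-(lam * t)) := by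
    filter_upwards [ae_restrict_mem measurableSet_Ioi] with t ht
    have : Real.exp (-(lam * t)) ≤ 1 :=
      Real.exp_le_one_iff.mpr (neg_nonpos.mpr (mul_nonneg hlam.le (mem_Ioi.mp ht).le))
    linarith
  have h1 := lintegral_comp_eq_lintegral_meas_lt_mul b.π (f := fun s : PosHalfLine => (s : ℝ))
    (g := fun t => 1 - Real.exp (-(lam * t))) (.of_forall fun s => (mem_Ioi.mp s.2).le)
    (by fun_prop) (fun t _ => Continuous.intervalIntegrable (by fun_prop) _ _) hnn
  simp_rw [integral_one_sub_exp hlam] at h1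
  rw [tailMeasure, lintegral_withDensity_eq_lintegral_mul _ b.measurable_tail (by fun_prop),
    ← integral_div, ofReal_integral_eq_lintegral_ofReal
      ((b.integrable_kernel hlam.le).div_const lam)
      (.of_forall fun r => div_nonneg (kernel_nonneg _ _) hlam.le), h1]
  rfl

lemma psi_div_eq (hα : b.α = 0) {lam : ℝ} (hlam : 0 < lam) :
    ENNReal.ofReal (b.psi lam / lam)
      = ∫⁻ r, ENNReal.ofReal (1 - Real.exp (-(lam * r))) ∂b.tailMeasure
        + ENNReal.ofReal (b.σ ^ 2 / 2 * lam) := by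
  rw [b.lintegral_tailMeasure hlam, ← ENNReal.ofReal_add
    (div_nonneg (b.integral_kernel_nonneg lam) hlam.le) (by positivity), psi, hα]
  congr 1
  field_simp
  ring

lemma tailMeasure_Ioi_ne_top {r : ℝ} (hr : 0 < r) : b.tailMeasure (Ioi r) ≠ ∞ := by
  have h1 := b.lintegral_tailMeasure one_pos
  have hpos : 0 < 1 - Real.exp (-(1 * r)) := by
    have : Real.exp (-(1 * r)) < Real.exp 0 := Real.exp_lt_exp.mpr (by linarith)
    rw [Real.exp_zero] at this
    linarith
  have h2 := mul_meas_ge_le_lintegral (μ := b.tailMeasure)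
    (f := fun r => ENNReal.ofReal (1 - Real.exp (-(1 * r)))) (by fun_prop)
    (ENNReal.ofReal (1 - Real.exp (-(1 * r))))
  rw [h1] at h2
  have h3 := ne_top_of_le_ne_top ENNReal.ofReal_ne_top h2
  refine ne_top_of_le_ne_top (fun h => h3 ?_) (measure_mono fun x hx => ?_)
    (b := b.tailMeasure {x | ENNReal.ofReal (1 - Real.exp (-(1 * r)))
      ≤ ENNReal.ofReal (1 - Real.exp (-(1 * x)))})
  · rw [h]
    exact ENNReal.mul_top (ENNReal.ofReal_pos.mpr hpos).ne'
  · refine ENNReal.ofReal_le_ofReal (sub_le_sub_left (Real.exp_le_exp.mpr ?_) 1)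
    have := (mem_Ioi.mp hx).le
    linarith

/-! ### The potential measure with Laplace transform `λ / ψ(λ)` -/

/-- Finite approximations of the Lévy measure of the subordinator with Laplace exponent
`ψ(λ) / λ`. -/
def approxLevy (n : ℕ) : Measure ℝ :=
  b.tailMeasure.restrict (Ioi (1 / ((n : ℝ) + 1)))
    + ENNReal.ofReal (b.σ ^ 2 / 2 * ((n : ℝ) + 1)) • Measure.dirac (1 / ((n : ℝ) + 1))

instance (n : ℕ) : IsFiniteMeasure (b.approxLevy n) := by
  have h1 : IsFiniteMeasure (b.tailMeasure.restrict (Ioi (1 / ((n : ℝ) + 1)))) := ⟨by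
    rw [Measure.restrict_apply_univ]
    exact (b.tailMeasure_Ioi_ne_top (by positivity)).lt_top⟩
  have h2 : IsFiniteMeasure (ENNReal.ofReal (b.σ ^ 2 / 2 * ((n : ℝ) + 1))
    • Measure.dirac (1 / ((n : ℝ) + 1))) := Measure.smul_finite _ ENNReal.ofReal_ne_top
  unfold approxLevy
  infer_instance

lemma approxLevy_Iio (n : ℕ) : b.approxLevy n (Iio 0) = 0 := by
  have h : ¬ 1 / ((n : ℝ) + 1) < 0 := not_lt.mpr (by positivity)
  rw [approxLevy, Measure.add_apply, Measure.smul_apply, Measure.dirac_apply' _ measurableSet_Iio,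
    indicator_of_notMem (by simpa using h), smul_zero, add_zero]
  exact le_antisymm ((Measure.restrict_apply_le _ _).trans b.tailMeasure_Iio.le) bot_le

lemma tendsto_one_sub_exp_inv {lam : ℝ} (hlam : 0 < lam) :
    Tendsto (fun n : ℕ => ((n : ℝ) + 1) * (1 - Real.exp (-(lam * (1 / ((n : ℝ) + 1))))))
      atTop (𝓝 lam) := by
  have hz : Tendsto (fun n : ℕ => lam * (1 / ((n : ℝ) + 1))) atTop (𝓝[>] 0) := by
    refine tendsto_nhdsWithin_iff.mpr ⟨?_, .of_forall fun n => mem_Ioi.mpr (by positivity)⟩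
    simpa using tendsto_one_div_add_atTop_nhds_zero_nat.const_mul lam
  have h := (tendsto_one_sub_exp_div.comp hz).const_mul lam
  rw [mul_one] at h
  refine h.congr fun n => ?_
  simp only [Function.comp_apply]
  field_simp

/-- The truncated tails increase to `tailMeasure`, while jumps of size `1/(n+1)` at rate `(n+1)
σ²/2` imitate the drift `σ²/2`. -/
lemma tendsto_lintegral_approxLevy (hα : b.α = 0) {lam : ℝ} (hlam : 0 < lam) :
    Tendsto (fun n => ∫⁻ y, ENNReal.ofReal (1 - Real.exp (-(lam * y))) ∂b.approxLevy n) atTop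
      (𝓝 (ENNReal.ofReal (b.psi lam / lam))) := by
  have h1 : Tendsto (fun n : ℕ => ∫⁻ y in Ioi (1 / ((n : ℝ) + 1)),
      ENNReal.ofReal (1 - Real.exp (-(lam * y))) ∂b.tailMeasure) atTop
      (𝓝 (∫⁻ y, ENNReal.ofReal (1 - Real.exp (-(lam * y))) ∂b.tailMeasure)) := by
    simp_rw [← lintegral_indicator measurableSet_Ioi]
    refine lintegral_tendsto_of_tendsto_of_monotone
      (fun n => (Measurable.indicator (by fun_prop) measurableSet_Ioi).aemeasurable)
      (.of_forall fun y n m hnm => ?_) ?_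
    · exact indicator_le_indicator_of_subset (M := ℝ≥0∞)
        (Ioi_subset_Ioi (Nat.one_div_le_one_div hnm)) (fun _ => bot_le) y
    · have : ∀ᵐ y ∂b.tailMeasure, 0 < y := by
        rw [ae_iff]; simpa [Iic, not_lt] using b.tailMeasure_Iic
      filter_upwards [this] with y hy
      refine (tendsto_const_nhds (x := ENNReal.ofReal (1 - Real.exp (-(lam * y))))).congr' ?_
      filter_upwards [(tendsto_one_div_add_atTop_nhds_zero_nat (𝕜 := ℝ)).eventually_lt_const hy]
        with n hn
      rw [indicator_of_mem (mem_Ioi.mpr hn)]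
  have h2 := (ENNReal.continuous_ofReal.tendsto _).comp
    ((tendsto_one_sub_exp_inv hlam).const_mul (b.σ ^ 2 / 2))
  rw [b.psi_div_eq hα hlam]
  refine (h1.add h2).congr fun n => ?_
  rw [approxLevy, lintegral_add_measure, lintegral_smul_measure, lintegral_dirac' _ (by fun_prop),
    smul_eq_mul, ← ENNReal.ofReal_mul (by positivity), Function.comp_apply]
  congr 2
  ring

variable {b}

lemma exists_potential (hα : b.α = 0) (hG : b.GreyCondition) :
    ∃ U : Measure ℝ, U (Iio 0) = 0 ∧ ∀ lam, 0 < lam →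
      laplace U lam = ENNReal.ofReal (lam / b.psi lam) := by
  choose U hU0 hU using fun n => exists_laplace_eq_inv (b.approxLevy n) (b.approxLevy_Iio n)
  refine exists_measure_of_tendsto_laplace (l := atTop) hU0 (fun _ _ => ENNReal.ofReal_ne_top)
    fun lam hlam => ?_
  have hp := psi_pos hα.ge hG hlam
  have h := tendsto_inv_iff.mpr (b.tendsto_lintegral_approxLevy hα hlam)
  rw [← ENNReal.ofReal_inv_of_pos (div_pos hp hlam), inv_div] at h
  exact h.congr fun n => (hU n lam hlam).symm

end BranchingMechanism

namespace BranchingMechanism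

variable (b : BranchingMechanism)

/-! ### The renewal equation for the potential measure -/

/-- The integrated tail `r ↦ ∫_r^∞ π(s, ∞) ds`. -/
def intTail (r : ℝ) : ℝ≥0∞ := b.tailMeasure (Ioi r)

lemma antitone_intTail : Antitone b.intTail := fun _ _ h => measure_mono (Ioi_subset_Ioi h)

lemma measurable_intTail : Measurable b.intTail := b.antitone_intTail.measurable

/-- The measure `σ² / 2 δ₀ + (∫_r^∞ π(s, ∞) ds) dr`, with Laplace transform `ψ(λ) / λ²`. -/
def renewalKernel : Measure ℝ :=
  ENNReal.ofReal (b.σ ^ 2 / 2) • Measure.dirac 0 + (volume.restrict (Ioi 0)).withDensity b.intTail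

instance : SFinite b.renewalKernel := by
  have : IsFiniteMeasure (ENNReal.ofReal (b.σ ^ 2 / 2) • Measure.dirac (0 : ℝ)) :=
    Measure.smul_finite _ ENNReal.ofReal_ne_top
  unfold renewalKernel
  infer_instance

lemma renewalKernel_Iio : b.renewalKernel (Iio 0) = 0 := by
  have h : (volume.restrict (Ioi 0)).withDensity b.intTail (Iio 0) = 0 := by
    refine withDensity_absolutelyContinuous _ _ ?_
    rw [Measure.restrict_apply measurableSet_Iio]
    simp [Iio_inter_Ioi]
  rw [renewalKernel, Measure.add_apply, h]
  simp

lemma laplace_renewalKernel (hα : b.α = 0) {lam : ℝ} (hlam : 0 < lam) :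
    laplace b.renewalKernel lam
      = ENNReal.ofReal (b.psi lam / lam) * ENNReal.ofReal (1 / lam) := by
  have h1 := lintegral_comp_eq_lintegral_meas_lt_mul b.tailMeasure (f := fun s => s)
    (g := fun t => Real.exp (-(lam * t))) (ae_nonneg_of_Iio b.tailMeasure_Iio)
    (by fun_prop) (fun t _ => Continuous.intervalIntegrable (by fun_prop) _ _)
    (.of_forall fun t => (Real.exp_pos _).le)
  simp_rw [integral_exp_neg_mul hlam, div_eq_mul_one_div (_ - _) lam] at h1
  have h2 : laplace ((volume.restrict (Ioi 0)).withDensity b.intTail) lam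
      = (∫⁻ r, ENNReal.ofReal (1 - Real.exp (-(lam * r))) ∂b.tailMeasure)
        * ENNReal.ofReal (1 / lam) := by
    rw [laplace, lintegral_withDensity_eq_lintegral_mul _ b.measurable_intTail (by fun_prop),
      ← lintegral_mul_const _ (by fun_prop)]
    refine h1.symm.trans (lintegral_congr fun r => ?_)
    rw [ENNReal.ofReal_mul' (by positivity)]
  have h3 : ENNReal.ofReal (b.σ ^ 2 / 2 * lam) * ENNReal.ofReal (1 / lam)
      = ENNReal.ofReal (b.σ ^ 2 / 2) := by
    rw [← ENNReal.ofReal_mul (by positivity), mul_assoc, mul_one_div_cancel hlam.ne', mul_one]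
  rw [renewalKernel, laplace_add, laplace_smul, laplace_dirac, h2, b.psi_div_eq hα hlam, add_mul,
    h3, add_comm]
  simp

/-- `U` is the measure on the half-line with Laplace transform `λ / ψ(λ)`. -/
structure IsPotential (U : Measure ℝ) : Prop where
  Iio_zero : U (Iio 0) = 0
  laplace_eq : ∀ lam, 0 < lam → laplace U lam = ENNReal.ofReal (lam / b.psi lam)

variable {b} {U : Measure ℝ}

namespace IsPotential

lemma sfinite (hU : b.IsPotential U) : SFinite U :=
  sfinite_of_laplace_ne_top (lam := 1) (by
    rw [hU.laplace_eq 1 one_pos]; exact ENNReal.ofReal_ne_top)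

lemma measure_Iic_ne_top (hU : b.IsPotential U) (x : ℝ) : U (Iic x) ≠ ∞ := by
  have h2 := mul_meas_ge_le_lintegral (μ := U)
    (f := fun r => ENNReal.ofReal (Real.exp (-(1 * r)))) (by fun_prop)
    (ENNReal.ofReal (Real.exp (-(1 * x))))
  have h3 := ne_top_of_le_ne_top ENNReal.ofReal_ne_top (h2.trans (hU.laplace_eq 1 one_pos).le)
  refine ne_top_of_le_ne_top (fun h => h3 ?_) (measure_mono fun y hy => ?_)
    (b := U {y | ENNReal.ofReal (Real.exp (-(1 * x))) ≤ ENNReal.ofReal (Real.exp (-(1 * y)))})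
  · rw [h]
    exact ENNReal.mul_top (ENNReal.ofReal_pos.mpr (Real.exp_pos _)).ne'
  · refine ENNReal.ofReal_le_ofReal (Real.exp_le_exp.mpr ?_)
    have := mem_Iic.mp hy
    linarith

/-- On transforms: `λ/ψ(λ)` times `ψ(λ)/λ²` is `1/λ`. -/
lemma conv_renewalKernel (hU : b.IsPotential U) (hα : b.α = 0) (hG : b.GreyCondition) :
    U.conv b.renewalKernel = volume.restrict (Ioi 0) := by
  have hlap (lam : ℝ) (hlam : 0 < lam) :
      laplace (U.conv b.renewalKernel) lam = laplace (volume.restrict (Ioi 0)) lam := by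
    have hp := psi_pos hα.ge hG hlam
    rw [laplace_conv, hU.laplace_eq lam hlam, b.laplace_renewalKernel hα hlam,
      laplace_volume_Ioi hlam, ← mul_assoc, ← ENNReal.ofReal_mul (by positivity),
      div_mul_div_cancel₀ hp.ne', div_self hlam.ne', ENNReal.ofReal_one, one_mul]
  refine ext_of_laplace (conv_Iio hU.Iio_zero b.renewalKernel_Iio) ?_ 0 (fun lam hlam => ?_) hlap
  · rw [Measure.restrict_apply measurableSet_Iio]
    simp [Iio_inter_Ioi]
  · rw [hlap lam hlam, laplace_volume_Ioi hlam]
    exact ENNReal.ofReal_ne_top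

/-- An atom at `a` contributes `U {a} exp(-λ a) ψ(λ)/λ²` to the convolution on `[a, ∞)`, where
Lebesgue measure has transform only `exp(-λ a)/λ`. So `U {a} ψ(λ)/λ ≤ 1`, while `ψ(λ)/λ → ∞`. -/
lemma measure_singleton (hU : b.IsPotential U) (hα : b.α = 0) (hG : b.GreyCondition) (a : ℝ) :
    U {a} = 0 := by
  rcases lt_or_ge a 0 with ha | ha
  · exact measure_mono_null (singleton_subset_iff.mpr ha) hU.Iio_zero
  have hbound (lam : ℝ) (hlam : 0 < lam) : U {a} * ENNReal.ofReal (b.psi lam / lam) ≤ 1 := by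
    let g : ℝ → ℝ≥0∞ := (Ici a).indicator fun z => ENNReal.ofReal (Real.exp (-(lam * z)))
    have hg : Measurable g := Measurable.indicator (by fun_prop) measurableSet_Ici
    have hle : ∫⁻ z, g z ∂(U.conv b.renewalKernel)
        ≤ ENNReal.ofReal (Real.exp (-(lam * a)) / lam) := by
      rw [hU.conv_renewalKernel hα hG, lintegral_indicator measurableSet_Ici,
        ← lintegral_exp_Ioi hlam, restrict_Ioi_eq_restrict_Ici (a := a)]
      exact lintegral_mono' (Measure.restrict_mono le_rfl Measure.restrict_le_self) le_rfl
    have hge : U {a} * (ENNReal.ofReal (Real.exp (-(lam * a))) * laplace b.renewalKernel lam)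
        ≤ ∫⁻ z, g z ∂(U.conv b.renewalKernel) := by
      rw [Measure.lintegral_conv hg]
      refine le_trans (le_of_eq ?_) (setLIntegral_le_lintegral {a} _)
      rw [lintegral_singleton, mul_comm, laplace, ← lintegral_const_mul _ (by fun_prop)]
      congr 1
      refine lintegral_congr_ae ?_
      filter_upwards [ae_nonneg_of_Iio b.renewalKernel_Iio] with x hx
      rw [← ofReal_exp_add]
      change _ = (Ici a).indicator (fun z => ENNReal.ofReal (Real.exp (-(lam * z)))) (a + x)
      rw [indicator_of_mem (show a + x ∈ Ici a from le_add_of_nonneg_right hx)]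
    have h := hge.trans hle
    rw [b.laplace_renewalKernel hα hlam, div_eq_mul_one_div (Real.exp _),
      ENNReal.ofReal_mul (Real.exp_pos _).le, mul_left_comm,
      ENNReal.mul_le_mul_iff_right (ENNReal.ofReal_pos.mpr (Real.exp_pos _)).ne'
        ENNReal.ofReal_ne_top, ← mul_assoc] at h
    refine (ENNReal.mul_le_mul_iff_left (c := ENNReal.ofReal (1 / lam)) ?_
      ENNReal.ofReal_ne_top).mp (by rwa [one_mul])
    exact (ENNReal.ofReal_pos.mpr (by positivity)).ne'
  by_contra h0
  have h1 : Tendsto (fun lam => U {a} * ENNReal.ofReal (b.psi lam / lam)) atTop (𝓝 (U {a} * ∞)) :=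
    ENNReal.Tendsto.const_mul (ENNReal.tendsto_ofReal_atTop.comp
      (tendsto_psi_div_atTop hα.ge hG)) (Or.inl ENNReal.top_ne_zero)
  rw [ENNReal.mul_top h0] at h1
  have h2 : (∞ : ℝ≥0∞) ≤ 1 := le_of_tendsto h1 (by
    filter_upwards [eventually_gt_atTop 0] with lam hlam using hbound lam hlam)
  simp at h2

/-- The integrated tail is flat on an interval only if the tail vanishes at its right end, hence
beyond it by monotonicity. -/
lemma intTail_eq_zero {r s : ℝ} (hr : 0 < r) (hrs : r < s) (h : b.intTail r = b.intTail s) :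
    b.intTail s = 0 := by
  have h1 : b.tailMeasure (Ioc r s) = 0 := by
    have h2 : b.tailMeasure (Ioi r) = b.tailMeasure (Ioc r s) + b.tailMeasure (Ioi s) := by
      rw [← measure_union (Ioc_disjoint_Ioi le_rfl) measurableSet_Ioi, Ioc_union_Ioi_eq_Ioi hrs.le]
    change b.tailMeasure (Ioi r) = b.tailMeasure (Ioi s) at h
    rw [h] at h2
    exact ((ENNReal.add_left_inj (b.tailMeasure_Ioi_ne_top (hr.trans hrs))).mp
      ((zero_add _).trans h2)).symm
  have h3 : b.tail s = 0 := by
    have h4 : b.tail s * volume (Ioc r s) ≤ b.tailMeasure (Ioc r s) := by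
      have hsub : Ioc r s ⊆ Ioi 0 := fun x hx => hr.trans hx.1
      rw [tailMeasure, withDensity_apply _ measurableSet_Ioc, Measure.restrict_restrict
        measurableSet_Ioc, inter_eq_left.mpr hsub, ← setLIntegral_const]
      exact setLIntegral_mono b.measurable_tail fun x hx => b.antitone_tail hx.2
    rw [h1, nonpos_iff_eq_zero, mul_eq_zero] at h4
    refine h4.resolve_right ?_
    rw [Real.volume_Ioc]
    exact (ENNReal.ofReal_pos.mpr (sub_pos.mpr hrs)).ne'
  rw [intTail, tailMeasure, withDensity_apply _ measurableSet_Ioi,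
    setLIntegral_congr_fun (g := fun _ => 0) measurableSet_Ioi fun x hx =>
      le_antisymm ((b.antitone_tail (mem_Ioi.mp hx).le).trans h3.le) bot_le]
  simp

/-- On a gap of `U`, only points `y ≤ a` contribute to the convolution: points beyond `c` lie too
far right, and the atom of the kernel at `0` reproduces `U`, which has no mass there. The renewal
density is thus the integrated tail alone, and it equals `1` almost everywhere. -/
lemma setLIntegral_eq_volume (hU : b.IsPotential U) (hα : b.α = 0) (hG : b.GreyCondition)
    {a c : ℝ} (ha : 0 ≤ a) (h0 : U (Ioc a c) = 0) {s : Set ℝ} (hs : MeasurableSet s)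
    (hsub : s ⊆ Ioo a c) :
    ∫⁻ z in s, (∫⁻ y in Iic a, b.intTail (z - y) ∂U) = volume s := by
  have hsf := hU.sfinite
  have hK := b.measurable_intTail
  have h1 : volume s = ∫⁻ z, s.indicator 1 z ∂(U.conv b.renewalKernel) := by
    have hpos : s ⊆ Ioi 0 := fun x hx => ha.trans_lt (hsub hx).1
    rw [hU.conv_renewalKernel hα hG, lintegral_indicator_one hs, Measure.restrict_apply hs,
      inter_eq_left.mpr hpos]
  have hinner : ∀ᵐ y ∂U, ∫⁻ x, s.indicator (1 : ℝ → ℝ≥0∞) (y + x) ∂b.renewalKernel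
      = (Iic a).indicator (fun y => ∫⁻ z in s, b.intTail (z - y)) y := by
    have hae : ∀ᵐ y ∂U, y ∉ Ioc a c := measure_eq_zero_iff_ae_notMem.mp h0
    filter_upwards [hae] with y hy
    have hind : Measurable fun x => s.indicator (1 : ℝ → ℝ≥0∞) (y + x) :=
      (measurable_one.indicator hs).comp (measurable_const_add y)
    by_cases hya : y ≤ a
    · rw [indicator_of_mem (mem_Iic.mpr hya), renewalKernel, lintegral_add_measure,
        lintegral_smul_measure, lintegral_dirac' _ hind, indicator_of_notMem (s := s), smul_zero, zero_add,
        lintegral_withDensity_eq_lintegral_mul _ hK hind,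
        ← lintegral_indicator measurableSet_Ioi, ← lintegral_sub_right_eq_self _ y,
        ← lintegral_indicator hs]
      · refine lintegral_congr fun z => ?_
        by_cases hz : z ∈ s
        · have hzy : z - y ∈ Ioi (0 : ℝ) := mem_Ioi.mpr (by linarith [(hsub hz).1])
          simp [hz, indicator_of_mem hzy]
        · simp [hz, indicator]
      · intro h
        rw [add_zero] at h
        linarith [(hsub h).1]
    · rw [indicator_of_notMem (by simpa using hya)]
      have hyc : c < y := by
        by_contra hcon
        exact hy ⟨not_le.mp hya, not_lt.mp hcon⟩
      refine (lintegral_congr_ae ?_).trans lintegral_zero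
      filter_upwards [ae_nonneg_of_Iio b.renewalKernel_Iio] with x hx
      exact indicator_of_notMem (fun h => by linarith [(hsub h).2]) _
  rw [h1, Measure.lintegral_conv (measurable_one.indicator hs), lintegral_congr_ae hinner,
    lintegral_indicator measurableSet_Iic, lintegral_lintegral_swap]
  exact (hK.comp (measurable_fst.sub measurable_snd)).aemeasurable

/-- On a gap the density `g` is `1` almost everywhere, yet it is an integral of the nonincreasing
functions `z ↦ intTail (z - y)`. Constancy forces these to be flat for almost every `y`, hence zero
at the later point, so `g` would be both `1` and `0` there. -/
lemma measure_Ioc_pos (hU : b.IsPotential U) (hα : b.α = 0) (hG : b.GreyCondition)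
    {a c : ℝ} (ha : 0 ≤ a) (hac : a < c) : U (Ioc a c) ≠ 0 := by
  intro h0
  have hsf := hU.sfinite
  have hK := b.measurable_intTail
  let g : ℝ → ℝ≥0∞ := fun z => ∫⁻ y in Iic a, b.intTail (z - y) ∂U
  have hg : Measurable g := Measurable.lintegral_prod_right'
    (f := fun p : ℝ × ℝ => b.intTail (p.1 - p.2)) (hK.comp (measurable_fst.sub measurable_snd))
  have hg1 : g =ᵐ[volume.restrict (Ioo a c)] 1 := by
    refine ae_eq_of_forall_setLIntegral_eq_of_sigmaFinite hg measurable_one fun s hs _ => ?_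
    rw [Measure.restrict_restrict hs, hU.setLIntegral_eq_volume hα hG ha h0
      (hs.inter measurableSet_Ioo) inter_subset_right]
    simp
  have hex {u v : ℝ} (hu : a ≤ u) (huv : u < v) (hv : v ≤ c) : ∃ x ∈ Ioo u v, g x = 1 := by
    have h1 : ∀ᵐ x ∂volume.restrict (Ioo u v), g x = 1 :=
      ae_restrict_of_ae_restrict_of_subset (Ioo_subset_Ioo hu hv) hg1
    have h2 : ∀ᵐ x ∂volume.restrict (Ioo u v), x ∈ Ioo u v := ae_restrict_mem measurableSet_Ioo
    have h3 : (ae (volume.restrict (Ioo u v))).NeBot := by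
      rw [ae_restrict_neBot, Real.volume_Ioo]
      exact (ENNReal.ofReal_pos.mpr (sub_pos.mpr huv)).ne'
    exact (h2.and h1).exists
  -- One point in each half of the gap, so that the two are strictly ordered.
  obtain ⟨x₁, hx₁, hg₁⟩ := hex le_rfl (left_lt_add_div_two.mpr hac) (add_div_two_lt_right.mpr hac).le
  obtain ⟨x₂, hx₂, hg₂⟩ := hex (left_lt_add_div_two.mpr hac).le (add_div_two_lt_right.mpr hac) le_rfl
  have hlt : x₁ < x₂ := hx₁.2.trans hx₂.1
  have hmeas (x : ℝ) : Measurable fun y => b.intTail (x - y) :=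
    hK.comp (measurable_const.sub measurable_id)
  have hae : (fun y => b.intTail (x₂ - y)) =ᵐ[U.restrict (Iic a)] fun y => b.intTail (x₁ - y) := by
    refine ae_eq_of_ae_le_of_lintegral_le
      (.of_forall fun y => b.antitone_intTail (by linarith)) ?_ (hmeas x₁).aemeasurable ?_
    · change g x₂ ≠ ∞
      rw [hg₂]
      exact ENNReal.one_ne_top
    · exact hg₁.le.trans hg₂.ge
  have hz : g x₂ = 0 := by
    refine (lintegral_congr_ae ?_).trans lintegral_zero
    filter_upwards [hae, ae_restrict_mem measurableSet_Iic] with y hy hya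
    have := mem_Iic.mp hya
    exact intTail_eq_zero (r := x₁ - y) (by linarith [hx₁.1]) (by linarith) hy.symm
  rw [hg₂] at hz
  exact one_ne_zero hz

/-! ### The scale function -/

/-- Tonelli: integrating `exp(-λ x)` over `x ≥ y` turns `λ/ψ(λ)` into `1/ψ(λ)`. -/
lemma lintegral_exp_mul_measure_Iic (hU : b.IsPotential U) (hα : b.α = 0) (hG : b.GreyCondition)
    {lam : ℝ} (hlam : 0 < lam) :
    ∫⁻ x in Ioi 0, ENNReal.ofReal (Real.exp (-(lam * x))) * U (Iic x)
      = ENNReal.ofReal (1 / b.psi lam) := by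
  have hsf := hU.sfinite
  have hp := psi_pos hα.ge hG hlam
  have hmeas : Measurable fun p : ℝ × ℝ =>
      {p : ℝ × ℝ | p.2 ≤ p.1}.indicator (fun p => ENNReal.ofReal (Real.exp (-(lam * p.1)))) p :=
    Measurable.indicator (by fun_prop) (measurableSet_le measurable_snd measurable_fst)
  calc ∫⁻ x in Ioi 0, ENNReal.ofReal (Real.exp (-(lam * x))) * U (Iic x)
      = ∫⁻ x in Ioi 0, ∫⁻ y, {p : ℝ × ℝ | p.2 ≤ p.1}.indicator
          (fun p => ENNReal.ofReal (Real.exp (-(lam * p.1)))) (x, y) ∂U := by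
        refine lintegral_congr fun x => ?_
        rw [← setLIntegral_const, ← lintegral_indicator measurableSet_Iic]
        rfl
    _ = ∫⁻ y, (∫⁻ x in Ioi 0, {p : ℝ × ℝ | p.2 ≤ p.1}.indicator
          (fun p => ENNReal.ofReal (Real.exp (-(lam * p.1)))) (x, y)) ∂U :=
        lintegral_lintegral_swap hmeas.aemeasurable
    _ = ∫⁻ y, ENNReal.ofReal (Real.exp (-(lam * y))) * ENNReal.ofReal (1 / lam) ∂U := by
        refine lintegral_congr_ae ?_
        filter_upwards [ae_nonneg_of_Iio hU.Iio_zero] with y hy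
        rw [← ENNReal.ofReal_mul (Real.exp_pos _).le, mul_one_div, ← lintegral_exp_Ioi hlam,
          restrict_Ioi_eq_restrict_Ici, restrict_Ioi_eq_restrict_Ici,
          ← lintegral_indicator measurableSet_Ici, ← lintegral_indicator measurableSet_Ici]
        refine lintegral_congr fun x => ?_
        simp only [indicator, mem_Ici, mem_ofPred_eq]
        split_ifs <;> first | rfl | linarith
    _ = ENNReal.ofReal (1 / b.psi lam) := by
        rw [lintegral_mul_const _ (by fun_prop)]
        change laplace U lam * _ = _
        rw [hU.laplace_eq lam hlam, ← ENNReal.ofReal_mul (by positivity)]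
        congr 1
        field_simp

lemma continuous_measure_Iic (hU : b.IsPotential U) (hα : b.α = 0) (hG : b.GreyCondition) :
    Continuous fun x => (U (Iic x)).toReal := by
  rw [continuous_iff_continuousAt]
  intro x₀
  have hfin : IsFiniteMeasure (U.restrict (Iic (x₀ + 1))) :=
    ⟨by rw [Measure.restrict_apply_univ]; exact (hU.measure_Iic_ne_top _).lt_top⟩
  have hcont : ContinuousAt (fun x => ∫ y, (Iic x).indicator (1 : ℝ → ℝ) y
      ∂(U.restrict (Iic (x₀ + 1)))) x₀ := by
    refine continuousAt_of_dominated (bound := fun _ => 1) (.of_forall fun x => ?_)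
      (.of_forall fun x => .of_forall fun y => ?_) (integrable_const 1) ?_
    · exact (measurable_one.indicator measurableSet_Iic).aestronglyMeasurable
    · by_cases h : y ∈ Iic x <;> simp [h]
    · have hne : ∀ᵐ y ∂U.restrict (Iic (x₀ + 1)), y ≠ x₀ := by
        refine ae_restrict_of_ae ?_
        rw [ae_iff]
        simpa using hU.measure_singleton hα hG x₀
      filter_upwards [hne] with y hy
      rcases lt_or_gt_of_ne hy with h | h
      · refine continuousAt_const.congr (f := fun _ => 1) ?_
        filter_upwards [Ioi_mem_nhds h] with x hx
        rw [indicator_of_mem (mem_Iic.mpr (mem_Ioi.mp hx).le), Pi.one_apply]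
      · refine continuousAt_const.congr (f := fun _ => 0) ?_
        filter_upwards [Iio_mem_nhds h] with x hx
        rw [indicator_of_notMem (by simpa using hx)]
  refine hcont.congr ?_
  filter_upwards [Iio_mem_nhds (lt_add_one x₀)] with x hx
  rw [integral_indicator_one measurableSet_Iic, Measure.real,
    Measure.restrict_apply measurableSet_Iic,
    inter_eq_left.mpr (Iic_subset_Iic.mpr (mem_Iio.mp hx).le)]

lemma isScaleFunction (hU : b.IsPotential U) (hα : b.α = 0) (hG : b.GreyCondition) :
    IsScaleFunction b fun x => (U (Iic x)).toReal where
  zero_of_neg x hx := by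
    rw [measure_mono_null (Iic_subset_Iio.mpr hx) hU.Iio_zero, ENNReal.toReal_zero]
  continuousOn := (hU.continuous_measure_Iic hα hG).continuousOn
  strictMonoOn x hx y _ hxy := by
    refine (ENNReal.toReal_lt_toReal (hU.measure_Iic_ne_top x) (hU.measure_Iic_ne_top y)).mpr ?_
    rw [← Iic_union_Ioc_eq_Iic hxy.le, measure_union (Iic_disjoint_Ioc le_rfl) measurableSet_Ioc]
    exact ENNReal.lt_add_right (hU.measure_Iic_ne_top x) (hU.measure_Ioc_pos hα hG hx hxy)
  nonneg _ _ := ENNReal.toReal_nonneg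
  laplace lam hlam := by
    have hcont := hU.continuous_measure_Iic hα hG
    have hp := psi_pos hα.ge hG hlam
    rw [integral_eq_lintegral_of_nonneg_ae
      (.of_forall fun x => mul_nonneg (Real.exp_pos _).le ENNReal.toReal_nonneg)
      (Continuous.aestronglyMeasurable (by fun_prop))]
    refine (congrArg ENNReal.toReal ?_).trans (ENNReal.toReal_ofReal (one_div_pos.mpr hp).le)
    rw [← hU.lintegral_exp_mul_measure_Iic hα hG hlam]
    refine lintegral_congr fun x => ?_
    rw [ENNReal.ofReal_mul (Real.exp_pos _).le, ENNReal.ofReal_toReal (hU.measure_Iic_ne_top x)]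

/-- The division by `x` is an integration in the transform variable: `exp(-λ x)/x` is the integral
of `exp(-u x)` over `u > λ`, and Tonelli leaves the integral of `1/ψ`. -/
lemma laplacePos_scaleMeasure (hU : b.IsPotential U) (hα : b.α = 0) (hG : b.GreyCondition)
    {lam : ℝ} (hlam : 0 < lam) :
    laplacePos (scaleMeasure fun x => (U (Iic x)).toReal) lam = ENNReal.ofReal (b.phi lam) := by
  have hcont := hU.continuous_measure_Iic hα hG
  have hUmeas : Measurable fun x => U (Iic x) :=
    Monotone.measurable fun x y h => measure_mono (Iic_subset_Iic.mpr h)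
  have hWmeas : Measurable fun x => (U (Iic x)).toReal := hUmeas.ennreal_toReal
  have hd : Measurable fun x : PosHalfLine =>
      ENNReal.ofReal ((U (Iic (x : ℝ))).toReal / (x : ℝ)) :=
    ((hWmeas.comp measurable_subtype_coe).div measurable_subtype_coe).ennreal_ofReal
  calc laplacePos (scaleMeasure fun x => (U (Iic x)).toReal) lam
      = ∫⁻ x in Ioi (0 : ℝ), ENNReal.ofReal ((U (Iic x)).toReal / x)
          * ENNReal.ofReal (Real.exp (-(lam * x))) := by
        rw [laplacePos, scaleMeasure, lintegral_withDensity_eq_lintegral_mul _ hd (by fun_prop)]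
        exact lintegral_subtype_comap measurableSet_Ioi
          fun x : ℝ => ENNReal.ofReal ((U (Iic x)).toReal / x)
            * ENNReal.ofReal (Real.exp (-(lam * x)))
    _ = ∫⁻ x in Ioi (0 : ℝ), ∫⁻ u in Ioi lam,
          ENNReal.ofReal (Real.exp (-(u * x))) * U (Iic x) := by
        refine setLIntegral_congr_fun measurableSet_Ioi fun x hx => ?_
        have hx : 0 < x := hx
        have h1 := lintegral_exp_Ioi hx lam
        simp_rw [mul_comm x] at h1
        rw [lintegral_mul_const _ (by fun_prop), h1, ← ENNReal.ofReal_mul (by positivity),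
          ← ENNReal.ofReal_toReal (hU.measure_Iic_ne_top x), ← ENNReal.ofReal_mul (by positivity),
          ENNReal.ofReal_toReal (hU.measure_Iic_ne_top x)]
        congr 1
        field_simp
    _ = ∫⁻ u in Ioi lam, ∫⁻ x in Ioi (0 : ℝ),
          ENNReal.ofReal (Real.exp (-(u * x))) * U (Iic x) := by
        refine lintegral_lintegral_swap (Measurable.aemeasurable ?_)
        exact Measurable.mul (by fun_prop) (hUmeas.comp measurable_fst)
    _ = ∫⁻ u in Ioi lam, ENNReal.ofReal (1 / b.psi u) :=
        setLIntegral_congr_fun measurableSet_Ioi fun u hu =>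
          hU.lintegral_exp_mul_measure_Iic hα hG (hlam.trans hu)
    _ = ENNReal.ofReal (b.phi lam) := by
        rw [phi, ofReal_integral_eq_lintegral_ofReal (integrableOn_one_div_psi hα.ge hG hlam)]
        filter_upwards [ae_restrict_mem measurableSet_Ioi] with u hu
        exact (one_div_pos.mpr (psi_pos hα.ge hG (hlam.trans hu))).le

end IsPotential

end BranchingMechanism

/-! ### Local finiteness and conclusion -/

lemma isLocallyFiniteMeasure_of_laplacePos {ν : Measure PosHalfLine}
    (h : laplacePos ν 1 ≠ ∞) : IsLocallyFiniteMeasure ν := by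
  refine ⟨fun y => ⟨{z | (z : ℝ) < y + 1}, ?_, ?_⟩⟩
  · exact (isOpen_lt (by fun_prop) continuous_const).mem_nhds (lt_add_one (y : ℝ))
  · have h2 := mul_meas_ge_le_lintegral (μ := ν)
      (f := fun z : PosHalfLine => ENNReal.ofReal (Real.exp (-(1 * (z : ℝ))))) (by fun_prop)
      (ENNReal.ofReal (Real.exp (-(1 * ((y : ℝ) + 1)))))
    have h3 := ne_top_of_le_ne_top h h2
    refine lt_of_le_of_lt (measure_mono fun z hz => ?_) (lt_top_iff_ne_top.mpr fun h => h3 ?_)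
      (b := ν {z : PosHalfLine | ENNReal.ofReal (Real.exp (-(1 * ((y : ℝ) + 1))))
        ≤ ENNReal.ofReal (Real.exp (-(1 * (z : ℝ))))})
    · refine ENNReal.ofReal_le_ofReal (Real.exp_le_exp.mpr ?_)
      have : (z : ℝ) < y + 1 := hz
      linarith
    · rw [h]
      exact ENNReal.mul_top (ENNReal.ofReal_pos.mpr (Real.exp_pos _)).ne'

end CBP
end

theorem mainTheorem4 {Ω : Type*} [MeasurableSpace Ω] (b : CBP.BranchingMechanism)
    (hα : 0 ≤ b.α) (hG : b.GreyCondition)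
    (Pr : Kernel ℝ≥0 Ω) (Z : ℝ≥0 → Ω → ℝ≥0) (hZ : CBP.IsCBProcess b Pr Z) :
    (0 < b.α → ∃ ν : Measure CBP.PosHalfLine, CBP.IsYaglomDistribution b Pr Z ν ∧
      ∀ x : ℝ≥0, 0 < x →
        CBP.TendstoWeakly (CBP.normalizedTransition b Pr Z x) (ENNReal.ofReal (1 / b.α) • ν)) ∧
    (b.α = 0 → ∃ W : ℝ → ℝ, CBP.IsScaleFunction b W ∧
      CBP.IsStationary Pr Z (CBP.scaleMeasure W) ∧
      ∀ x : ℝ≥0, 0 < x →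
        CBP.TendstoVaguely (CBP.normalizedTransition b Pr Z x) (CBP.scaleMeasure W)) := by
  refine ⟨fun hα' => ?_, fun hα' => ?_⟩
  · obtain ⟨ν, hprob, hν⟩ := hZ.exists_yaglom_laplace hα' hG
    exact ⟨ν, hZ.isYaglomDistribution hα' hG hν,
      fun x hx => hZ.tendstoWeakly_normalizedTransition hα' hG hν hx⟩
  · obtain ⟨U, hU0, hUlap⟩ := CBP.BranchingMechanism.exists_potential hα' hG
    have hU : b.IsPotential U := ⟨hU0, hUlap⟩
    have hμ := fun lam (hlam : 0 < lam) => hU.laplacePos_scaleMeasure hα' hG hlam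
    have hloc := CBP.isLocallyFiniteMeasure_of_laplacePos (by
      rw [hμ 1 one_pos]; exact ENNReal.ofReal_ne_top)
    exact ⟨_, hU.isScaleFunction hα' hG, hZ.isStationary hα hG hμ,
      fun x hx => hZ.tendstoVaguely_normalizedTransition hα' hG hμ hx⟩
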